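/- **Setting.** A *trace* is a finite sequence $\sigma$ of events $\langle t, op\rangle$, where $t$ is a thread identifier and $op$ is a read $r(x)$ or write $w(x)$ of a variable $x$, or an acquire $acq(\ell)$ or release $rel(\ell)$ of a lock $\ell$. It is well-formed: for every lock $\ell$, the subsequence of the events on $\ell$ is a prefix of a concatenation of blocks $\langle t, acq(\ell)\rangle\langle t, rel(\ell)\rangle$. The critical section of an acquire event consists of the events of its thread from that event up to the matching release event (up to the end of the trace if there is none), and $\mathsf{lheld}_\sigma(e)$ is the set of locks $\ell$ such that $e$ lies in the critical section of some acquire event on $\ell$. Two events conflict if they are performed by different threads, access the same variable, and at least one of them is a write. The trace $\sigma$ has a *lock-set race* on a variable $x$ if there are conflicting events $e_1,e_2$ such that $e_1$ writes $x$ and $e_2$ accesses $x$, and $\bigcap_{e} \mathsf{lheld}_\sigma(e)=\emptyset$, the intersection being over all events $e$ that access $x$. *Lock-set race detection* asks whether a given trace $\sigma$ has a lock-set race on some variable; its size is the number $N$ of events of $\sigma$. Algorithms are (oracle, or nondeterministic) word RAM programs with unit-cost operations on words of $O(\log (T+\|x\|))$ bits, where $T$ is the time bound and $\|x\|$ is the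 length plus the sum of the input words. The input size of $k$-SAT (satisfiability of CNF formulas, given as sets of clauses with at most $k$ literals each) and of $k$-TAUT (whether a DNF formula, given as a set of terms with at most $k$ literals each, is a tautology) is the number $n$ of variables. *NSETH*: for every $\epsilon>0$ there is a $k$ such that $k$-TAUT is not in $\mathrm{NTIME}(2^{n(1-\epsilon)})$. Here $\mathrm{NTIME}(T)$ is the class of problems for which some nondeterministic program accepts exactly the yes-instances, each of them by some run of $O(T(n))$ steps. An *$(a,b)$-fine-grained reduction from SAT to a problem $B$* exists if for every $\epsilon'>0$ there is a $\delta>0$ such that for every $k$ there is a deterministic algorithm with an oracle for $B$ that decides $k$-SAT in $O(a(n)^{1-\delta})$ steps and whose queries, of sizes $m_1,\dots,m_q$, satisfy $\sum_{i=1}^q b(m_i)^{1-\epsilon'} = O(a(n)^{1-\delta})$; $\delta$ does not depend on $k$, but the algorithm and the implied constants may. (In particular, such a reduction exists whenever a single algorithm for CNF-SAT achieves these bounds up to a factor polynomial in the length of the formula.) **Theorem.** For every $\epsilon>0$, there is no $(2^{N}, N^{1+\epsilon})$-fine-grained reduction from SAT to lock-set race detection unless NSETH fails; that is, if such a reduction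 exists, then NSETH is false. -/

import Mathlib

namespace RaceComplexity

/-! ### Decision problems -/

/-- A decision problem: instances, their size parameter (the "`n`" of a running time),
an injective encoding by a list of words, and the yes-instances. -/
structure Problem where
  Inst : Type
  size : Inst → ℕ
  encode : Inst → List ℕ
  encode_injective : Function.Injective encode
  Yes : Inst → Prop

/-- An oracle: `O q m b` says that the word list `q` is a legal query, of size `m`,
with answer `b`. -/
abbrev Oracle := List ℕ → ℕ → Bool → Prop

/-- The oracle of a problem. Legal queries are exactly the encodings of instances. -/
def Problem.oracle (B : Problem) : Oracle := fun q m b =>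
  ∃ y : B.Inst, B.encode y = q ∧ B.size y = m ∧ (b = true ↔ B.Yes y)

/-- The oracle without legal queries: a machine that queries it gets stuck. -/
def noOracle : Oracle := fun _ _ _ => False

/-! ### Word RAM -/

/-- The arithmetic and bitwise operations on words (`sub` is truncated at `0`). -/
inductive BinOp where
  | add | sub | mul | div | mod | land | lor | xor | shl | shr

def BinOp.eval : BinOp → ℕ → ℕ → ℕ
  | .add, a, b => a + b
  | .sub, a, b => a - b
  | .mul, a, b => a * b
  | .div, a, b => a / b
  | .mod, a, b => a % b
  | .land, a, b => a &&& b
  | .lor, a, b => a ||| b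
  | .xor, a, b => a ^^^ b
  | .shl, a, b => a <<< b
  | .shr, a, b => a >>> b

/-- Programs of a random access machine. A program mentions finitely many registers and finitely
many arrays; array cells are addressed by register contents. -/
inductive Prog where
  | skip
  /-- `reg r := v` -/
  | const (r v : ℕ)
  /-- `reg r := o (reg a) (reg b)` -/
  | op (o : BinOp) (r a b : ℕ)
  /-- `reg r := mem A (reg a)` -/
  | load (r A a : ℕ)
  /-- `mem A (reg a) := reg r` -/
  | store (A a r : ℕ)
  | seq (p q : Prog)
  /-- if `reg r ≠ 0` then `p` else `q` -/
  | ite (r : ℕ) (p q : Prog)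
  /-- while `reg r ≠ 0` do `p` -/
  | loop (r : ℕ) (p : Prog)
  /-- `reg r :=` a nondeterministically chosen word -/
  | guess (r : ℕ)
  /-- `reg r :=` the answer of the oracle to the query that consists of
  the `reg s` words `mem A (reg a), mem A (reg a + 1), …` -/
  | query (r A a s : ℕ)

/-- A program is deterministic if it contains no `guess`. -/
def Prog.Deterministic : Prog → Prop
  | .seq p q => p.Deterministic ∧ q.Deterministic
  | .ite _ p q => p.Deterministic ∧ q.Deterministic
  | .loop _ p => p.Deterministic
  | .guess _ => False
  | _ => True

/-- Machine states: the registers, and the arrays (`mem A i` is cell `i` of array `A`). -/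
structure State where
  reg : ℕ → ℕ
  mem : ℕ → ℕ → ℕ

def State.setReg (s : State) (r v : ℕ) : State :=
  ⟨Function.update s.reg r v, s.mem⟩

def State.setMem (s : State) (A i v : ℕ) : State :=
  ⟨s.reg, Function.update s.mem A (Function.update (s.mem A) i v)⟩

/-- The `len` words of array `A` that start at address `i`. -/
def State.block (s : State) (A i len : ℕ) : List ℕ :=
  (List.range len).map fun j => s.mem A (i + j)

/-- The initial state: the input stands in array `0`, its length in register `0`, and everything
else is `0`. -/
def initState (x : List ℕ) : State where
  reg := fun r => if r = 0 then x.length else 0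
  mem := fun A i => if A = 0 then x.getD i 0 else 0

/-- `Exec O W p s t Q s'`: with oracle `O`, program `p` has a run from state `s` to state `s'` that
takes `t` steps, makes queries of the sizes listed in `Q`, and writes no word larger than `W`.
Every executed elementary instruction and every evaluated test is one step. -/
inductive Exec (O : Oracle) (W : ℕ) : Prog → State → ℕ → List ℕ → State → Prop where
  | skip (s : State) : Exec O W .skip s 1 [] s
  | const (s : State) (r v : ℕ) (hv : v ≤ W) : Exec O W (.const r v) s 1 [] (s.setReg r v)
  | op (s : State) (o : BinOp) (r a b : ℕ) (hv : o.eval (s.reg a) (s.reg b) ≤ W) :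
      Exec O W (.op o r a b) s 1 [] (s.setReg r (o.eval (s.reg a) (s.reg b)))
  | load (s : State) (r A a : ℕ) (hv : s.mem A (s.reg a) ≤ W) :
      Exec O W (.load r A a) s 1 [] (s.setReg r (s.mem A (s.reg a)))
  | store (s : State) (A a r : ℕ) (hv : s.reg r ≤ W) :
      Exec O W (.store A a r) s 1 [] (s.setMem A (s.reg a) (s.reg r))
  | seq {p q : Prog} {s s' s'' : State} {t t' : ℕ} {Q Q' : List ℕ}
      (hp : Exec O W p s t Q s') (hq : Exec O W q s' t' Q' s'') :
      Exec O W (.seq p q) s (t + t') (Q ++ Q') s''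
  | ite_true {r : ℕ} {p q : Prog} {s s' : State} {t : ℕ} {Q : List ℕ} (hr : s.reg r ≠ 0)
      (hp : Exec O W p s t Q s') : Exec O W (.ite r p q) s (t + 1) Q s'
  | ite_false {r : ℕ} {p q : Prog} {s s' : State} {t : ℕ} {Q : List ℕ} (hr : s.reg r = 0)
      (hq : Exec O W q s t Q s') : Exec O W (.ite r p q) s (t + 1) Q s'
  | loop_done {r : ℕ} {p : Prog} {s : State} (hr : s.reg r = 0) :
      Exec O W (.loop r p) s 1 [] s
  | loop_again {r : ℕ} {p : Prog} {s s' s'' : State} {t t' : ℕ} {Q Q' : List ℕ}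
      (hr : s.reg r ≠ 0) (hp : Exec O W p s t Q s')
      (hl : Exec O W (.loop r p) s' t' Q' s'') :
      Exec O W (.loop r p) s (t + t' + 1) (Q ++ Q') s''
  | guess (s : State) (r v : ℕ) (hv : v ≤ W) : Exec O W (.guess r) s 1 [] (s.setReg r v)
  | query (s : State) (r A a l m : ℕ) (b : Bool)
      (hq : O (s.block A (s.reg a) (s.reg l)) m b) (hv : b.toNat ≤ W) :
      Exec O W (.query r A a l) s 1 [m] (s.setReg r b.toNat)

/-- A run on input `x` with output `b`: the output is "accept" iff register `0` is nonzero
at the end. -/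
def Outputs (O : Oracle) (W : ℕ) (p : Prog) (x : List ℕ) (t : ℕ) (Q : List ℕ) (b : Bool) : Prop :=
  ∃ s', Exec O W p (initState x) t Q s' ∧ (b = true ↔ s'.reg 0 ≠ 0)

/-- The largest word allowed to a machine with time bound `T` on input `x`: words have
`O(log (T + ‖x‖))` bits. -/
def wordBound (C : ℕ) (T : ℝ) (x : List ℕ) : ℝ :=
  C * (T + x.length + x.sum + 1) ^ C

/-! ### Nondeterministic time and fine-grained reductions -/

/-- `A ∈ NTIME(T)`: a nondeterministic word RAM program accepts exactly the yes-instances, and each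
yes-instance `x` has an accepting run of `O(T(size x))` steps. -/
def InNTIME (A : Problem) (T : ℕ → ℝ) : Prop :=
  ∃ (p : Prog) (C : ℕ), ∀ x : A.Inst,
    (A.Yes x → ∃ W t : ℕ, Outputs noOracle W p (A.encode x) t [] true ∧
      (t : ℝ) ≤ C * T (A.size x) ∧ (W : ℝ) ≤ wordBound C (T (A.size x)) (A.encode x)) ∧
    ((∃ W t : ℕ, Outputs noOracle W p (A.encode x) t [] true) → A.Yes x)

/-- An `(a, b)`-fine-grained reduction from the problems `A k` to `B`: for every `ε > 0` there is
`δ > 0`, not depending on `k`, such that each `A k` is decided by a deterministic algorithm with an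
oracle for `B` in `O(a(n)^(1-δ))` steps, whose queries, of sizes `m₁, …, m_q`, satisfy
`∑ b(m_i)^(1-ε) = O(a(n)^(1-δ))`. For a family with one member this is the usual notion for
a single problem. -/
def FineGrainedReduction {κ : Type} (A : κ → Problem) (a : ℕ → ℝ) (B : Problem) (b : ℕ → ℝ) :
    Prop :=
  ∀ ε : ℝ, 0 < ε → ∃ δ : ℝ, 0 < δ ∧ ∀ k : κ, ∃ (R : Prog) (C : ℕ), R.Deterministic ∧
    ∀ x : (A k).Inst, ∃ (W t : ℕ) (Q : List ℕ) (ans : Bool),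
      Outputs B.oracle W R ((A k).encode x) t Q ans ∧
      (ans = true ↔ (A k).Yes x) ∧
      (t : ℝ) ≤ C * a ((A k).size x) ^ (1 - δ) ∧
      (W : ℝ) ≤ wordBound C (a ((A k).size x) ^ (1 - δ)) ((A k).encode x) ∧
      (Q.map fun m => b m ^ (1 - ε)).sum ≤ C * a ((A k).size x) ^ (1 - δ)

/-! ### Satisfiability, tautologies, NSETH -/

/-- A `k`-CNF or `k`-DNF formula: a set (list without repetitions) of clauses or terms, each with
at most `k` literals, over the variables `0, …, vars - 1`. The literal `(i, true)` is the variable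
`i`, and `(i, false)` is its negation. -/
@[ext]
structure Formula (k : ℕ) where
  vars : ℕ
  clauses : List (List (ℕ × Bool))
  nodup : clauses.Nodup
  width : ∀ c ∈ clauses, c.length ≤ k
  inRange : ∀ c ∈ clauses, ∀ l ∈ c, l.1 < vars

def litCode (l : ℕ × Bool) : ℕ := 2 * l.1 + l.2.toNat

theorem litCode_injective : Function.Injective litCode := by
  rintro ⟨i, b⟩ ⟨j, c⟩ h
  cases b <;> cases c <;> simp [litCode] at h ⊢ <;> omega

/-- Each clause is written as its length followed by its literals. -/
def clausesCode (cs : List (List (ℕ × Bool))) : List ℕ :=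
  cs.flatMap fun c => c.length :: c.map litCode

theorem clausesCode_injective : Function.Injective clausesCode := by
  intro cs
  induction cs with
  | nil =>
    intro ds h
    cases ds with
    | nil => rfl
    | cons d ds => simp [clausesCode] at h
  | cons c cs ih =>
    intro ds h
    cases ds with
    | nil => simp [clausesCode] at h
    | cons d ds =>
      simp only [clausesCode, List.flatMap_cons, List.cons_append, List.cons.injEq] at h
      obtain ⟨hlen, h⟩ := h
      obtain ⟨h1, h2⟩ := List.append_inj h (by simpa using hlen)
      rw [List.map_injective_iff.2 litCode_injective h1, ih h2]

def Formula.code {k : ℕ} (φ : Formula k) : List ℕ := φ.vars :: clausesCode φ.clauses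

theorem Formula.code_injective {k : ℕ} : Function.Injective (Formula.code (k := k)) := by
  intro φ ψ h
  simp only [Formula.code, List.cons.injEq] at h
  exact Formula.ext h.1 (clausesCode_injective h.2)

/-- The CNF formula `φ` is satisfiable. -/
def Formula.CNFSatisfiable {k : ℕ} (φ : Formula k) : Prop :=
  ∃ v : ℕ → Bool, ∀ c ∈ φ.clauses, ∃ l ∈ c, v l.1 = l.2

/-- The DNF formula `φ` is a tautology. -/
def Formula.DNFTautology {k : ℕ} (φ : Formula k) : Prop :=
  ∀ v : ℕ → Bool, ∃ c ∈ φ.clauses, ∀ l ∈ c, v l.1 = l.2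

/-- `k`-SAT; the size parameter is the number of variables. -/
def kSAT (k : ℕ) : Problem where
  Inst := Formula k
  size := Formula.vars
  encode := Formula.code
  encode_injective := Formula.code_injective
  Yes := Formula.CNFSatisfiable

/-- `k`-TAUT; the size parameter is the number of variables. -/
def kTAUT (k : ℕ) : Problem where
  Inst := Formula k
  size := Formula.vars
  encode := Formula.code
  encode_injective := Formula.code_injective
  Yes := Formula.DNFTautology

/-- The nondeterministic strong exponential time hypothesis. -/
def NSETH : Prop :=
  ∀ ε : ℝ, 0 < ε → ∃ k : ℕ, ¬ InNTIME (kTAUT k) fun n => (2 : ℝ) ^ ((n : ℝ) * (1 - ε))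

/-! ### Traces and lock-set races -/

inductive Operation where
  | read (x : ℕ)
  | write (x : ℕ)
  | acq (l : ℕ)
  | rel (l : ℕ)
  deriving DecidableEq

@[ext]
structure Event where
  thread : ℕ
  op : Operation
  deriving DecidableEq

/-- The projection of a sequence of events to the lock `l`. -/
def lockProj (es : List Event) (l : ℕ) : List Event :=
  es.filter fun e => e.op = .acq l ∨ e.op = .rel l

/-- A trace is a sequence of events that is well-formed: for each lock `l`, the projection to `l` is
a prefix of a concatenation of blocks `⟨t, acq l⟩ ⟨t, rel l⟩`. -/
@[ext]
structure Trace where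
  events : List Event
  wellFormed : ∀ l : ℕ, ∃ ts : List ℕ,
    lockProj events l <+: ts.flatMap fun t => [⟨t, .acq l⟩, ⟨t, .rel l⟩]

namespace Trace

/-- The events of a trace, in trace order. -/
abbrev Ev (σ : Trace) := Fin σ.events.length

def thread (σ : Trace) (e : σ.Ev) : ℕ := (σ.events.get e).thread

def op (σ : Trace) (e : σ.Ev) : Operation := (σ.events.get e).op

def writes (σ : Trace) (x : ℕ) : Set σ.Ev := {e | σ.op e = .write x}

def reads (σ : Trace) (x : ℕ) : Set σ.Ev := {e | σ.op e = .read x}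

def accesses (σ : Trace) (x : ℕ) : Set σ.Ev := σ.reads x ∪ σ.writes x

/-- Thread order. -/
def ThreadLE (σ : Trace) (e f : σ.Ev) : Prop := e ≤ f ∧ σ.thread e = σ.thread f

/-- `f` is the release event that matches the acquire event `e` on the lock `l`. -/
def IsMatch (σ : Trace) (l : ℕ) (e f : σ.Ev) : Prop :=
  e < f ∧ σ.thread e = σ.thread f ∧ σ.op e = .acq l ∧ σ.op f = .rel l ∧
    ∀ g, e < g → g < f → σ.op g ≠ .acq l ∧ σ.op g ≠ .rel l

/-- The critical section of the acquire event `e` on the lock `l`; it extends to the end of the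
thread if there is no matching release event. -/
def crit (σ : Trace) (l : ℕ) (e : σ.Ev) : Set σ.Ev :=
  {f | σ.ThreadLE e f ∧ ∀ m, σ.IsMatch l e m → σ.ThreadLE f m}

/-- The locks held by the thread of `e` when `e` is executed. -/
def locksHeld (σ : Trace) (e : σ.Ev) : Set ℕ :=
  {l | ∃ f, σ.op f = .acq l ∧ e ∈ σ.crit l f}

def Conflicting (σ : Trace) (e f : σ.Ev) : Prop :=
  σ.thread e ≠ σ.thread f ∧
    ∃ x, e ∈ σ.accesses x ∧ f ∈ σ.accesses x ∧ (e ∈ σ.writes x ∨ f ∈ σ.writes x)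

/-- `σ` has a lock-set race on the variable `x`. -/
def HasLockSetRaceOn (σ : Trace) (x : ℕ) : Prop :=
  (∃ e ∈ σ.writes x, ∃ f ∈ σ.accesses x, σ.Conflicting e f) ∧
    (⋂ e ∈ σ.accesses x, σ.locksHeld e) = ∅

def HasLockSetRace (σ : Trace) : Prop := ∃ x, σ.HasLockSetRaceOn x

end Trace

def Event.code : Event → List ℕ
  | ⟨t, .read x⟩ => [t, 0, x]
  | ⟨t, .write x⟩ => [t, 1, x]
  | ⟨t, .acq l⟩ => [t, 2, l]
  | ⟨t, .rel l⟩ => [t, 3, l]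

def eventsCode (es : List Event) : List ℕ := es.flatMap Event.code

theorem eventsCode_injective : Function.Injective eventsCode := by
  intro es
  induction es with
  | nil =>
    intro fs h
    cases fs with
    | nil => rfl
    | cons f fs => rcases f with ⟨t, _ | _ | _ | _⟩ <;> simp [eventsCode, Event.code] at h
  | cons e es ih =>
    intro fs h
    cases fs with
    | nil => rcases e with ⟨t, _ | _ | _ | _⟩ <;> simp [eventsCode, Event.code] at h
    | cons f fs =>
      rw [eventsCode, eventsCode, List.flatMap_cons, List.flatMap_cons] at h
      obtain ⟨h1, h2⟩ := List.append_inj h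
        (by rcases e with ⟨t, _ | _ | _ | _⟩ <;> rcases f with ⟨u, _ | _ | _ | _⟩ <;> rfl)
      rw [ih h2]
      rcases e with ⟨t, _ | _ | _ | _⟩ <;> rcases f with ⟨u, _ | _ | _ | _⟩ <;>
        simp_all [Event.code]

/-- Lock-set race detection; the size of a trace is its number of events. -/
def lockSetRace : Problem where
  Inst := Trace
  size := fun σ => σ.events.length
  encode := fun σ => eventsCode σ.events
  encode_injective := fun _ _ h => Trace.ext (eventsCode_injective h)
  Yes := Trace.HasLockSetRace

end RaceComplexity

/-!
The proof turns a fine-grained reduction from SAT to lock-set race detection into fast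
nondeterministic programs for `k`-TAUT. A DNF formula is a tautology iff the CNF formula in which
every literal is negated is unsatisfiable, so the program negates the literals (`prepare`), runs the
reduction on the result (`simulate`), and accepts iff the reduction rejects.

The oracle queries of the reduction are replaced by guesses that are verified in linear time, which
is possible because both answers of lock-set race detection have certificates that can be checked
in linear time.
* A race on `x` is certified by `x` and a thread that writes `x`. One pass over the trace finds the
  conflicting accesses and, for each lock, an access to `x` without the lock. The latter takes only
  a constant number of operations per event since, while a lock does not change hands, it suffices
  to compare two values of a counter (`RaceInv`).
* The absence of races is certified by a label of each variable: it is never written, or only one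
  given thread accesses it, or a given lock is held during all accesses (`Explained`).

Both checks rest on `Trace.mem_locksHeld_iff`: in a well-formed trace, an access lies in a critical
section on `l` iff its thread is the current holder of `l`. Answers with wrong certificates block
the run, so every run that ends has answered all queries correctly and ends like the reduction
(`represents_of_exec_simulate`); and some run guesses all certificates (`exec_simulate`).

The reduction is used with the saving `ε / (1 + ε)` in the cost of its queries. Then a query of size
`m` costs `(m ^ (1 + ε)) ^ (1 - ε / (1 + ε)) = m`. So the total size of the queries, hence the time
of the simulation, is `O(2 ^ (n * (1 - δ)))`, and reading the formula takes time polynomial in `n`.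
This contradicts NSETH with `min δ 1 / 2` in the role of its `ε`.

Two devices keep the verification of the programs short. A program without guesses and queries has
at most one run on each state (`Exec.unique`), so a statement about one run is a statement about all
runs. And all programs written here are `Tame`: the largest word grows by at most one per step, so
that the word bound follows from the time bound.
-/

namespace RaceComplexity

/-! ### Runs of programs -/

theorem Exec.mono {O : Oracle} {W W' : ℕ} (hW : W ≤ W') {p : Prog} {s s' : State} {t : ℕ}
    {Q : List ℕ} (h : Exec O W p s t Q s') : Exec O W' p s t Q s' := by
  induction h with
  | skip s => exact .skip s
  | const s r v hv => exact .const s r v (hv.trans hW)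
  | op s o r a b hv => exact .op s o r a b (hv.trans hW)
  | load s r A a hv => exact .load s r A a (hv.trans hW)
  | store s A a r hv => exact .store s A a r (hv.trans hW)
  | seq _ _ ih1 ih2 => exact .seq ih1 ih2
  | ite_true hr _ ih => exact .ite_true hr ih
  | ite_false hr _ ih => exact .ite_false hr ih
  | loop_done hr => exact .loop_done hr
  | loop_again hr _ _ ih1 ih2 => exact .loop_again hr ih1 ih2
  | guess s r v hv => exact .guess s r v (hv.trans hW)
  | query s r A a l m b hq hv => exact .query s r A a l m b hq (hv.trans hW)

theorem Exec.unique {p : Prog} {W W' : ℕ} {s s₁ s₂ : State} {t t' : ℕ} {Q Q' : List ℕ}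
    (hd : p.Deterministic) (h : Exec noOracle W p s t Q s₁) (h' : Exec noOracle W' p s t' Q' s₂) :
    s₁ = s₂ := by
  induction h generalizing t' Q' s₂ with
  | skip s => cases h'; rfl
  | const s r v hv => cases h'; rfl
  | op s o r a b hv => cases h'; rfl
  | load s r A a hv => cases h'; rfl
  | store s A a r hv => cases h'; rfl
  | seq _ _ ih1 ih2 =>
    cases h' with
    | seq h1 h2 =>
      cases ih1 hd.1 h1
      exact ih2 hd.2 h2
  | ite_true hr _ ih =>
    cases h' with
    | ite_true _ h1 => exact ih hd.1 h1
    | ite_false h0 _ => exact absurd h0 hr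
  | ite_false hr _ ih =>
    cases h' with
    | ite_true h0 h1 => exact absurd hr h0
    | ite_false _ h1 => exact ih hd.2 h1
  | loop_done hr =>
    cases h' with
    | loop_done _ => rfl
    | loop_again h0 _ _ => exact absurd hr h0
  | loop_again hr _ _ ih1 ih2 =>
    cases h' with
    | loop_done h0 => exact absurd h0 hr
    | loop_again _ h1 h2 =>
      cases ih1 hd h1
      exact ih2 hd h2
  | guess s r v hv => exact hd.elim
  | query s r A a l m b hq hv => exact hq.elim

/-- The program `p` contains an instruction that writes register `r`. -/
def Prog.WritesReg (r : ℕ) : Prog → Prop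
  | .skip => False
  | .const r' _ => r = r'
  | .op _ r' _ _ => r = r'
  | .load r' _ _ => r = r'
  | .store _ _ _ => False
  | .seq p q => p.WritesReg r ∨ q.WritesReg r
  | .ite _ p q => p.WritesReg r ∨ q.WritesReg r
  | .loop _ p => p.WritesReg r
  | .guess r' => r = r'
  | .query r' _ _ _ => r = r'

/-- The program `p` contains an instruction that writes to array `A`. -/
def Prog.WritesArr (A : ℕ) : Prog → Prop
  | .store A' _ _ => A = A'
  | .seq p q => p.WritesArr A ∨ q.WritesArr A
  | .ite _ p q => p.WritesArr A ∨ q.WritesArr A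
  | .loop _ p => p.WritesArr A
  | _ => False

@[simp] theorem State.setReg_reg (s : State) (r v r' : ℕ) :
    (s.setReg r v).reg r' = if r' = r then v else s.reg r' := by
  simp [State.setReg, Function.update_apply]

@[simp] theorem State.setReg_mem (s : State) (r v : ℕ) : (s.setReg r v).mem = s.mem := rfl

@[simp] theorem State.setMem_reg (s : State) (A i v : ℕ) : (s.setMem A i v).reg = s.reg := rfl

@[simp] theorem State.setMem_mem (s : State) (A i v A' i' : ℕ) :
    (s.setMem A i v).mem A' i' = if A' = A ∧ i' = i then v else s.mem A' i' := by
  by_cases h : A' = A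
  · subst h
    simp [State.setMem, Function.update_apply]
  · simp [State.setMem, h]

theorem Exec.reg_eq {O : Oracle} {W : ℕ} {p : Prog} {s s' : State} {t : ℕ} {Q : List ℕ}
    (h : Exec O W p s t Q s') {r : ℕ} (hr : ¬ p.WritesReg r) : s'.reg r = s.reg r := by
  induction h with
  | skip s => rfl
  | const s r v hv => simp_all [Prog.WritesReg]
  | op s o r a b hv => simp_all [Prog.WritesReg]
  | load s r A a hv => simp_all [Prog.WritesReg]
  | store s A a r hv => rfl
  | seq _ _ ih1 ih2 => simp_all [Prog.WritesReg]
  | ite_true hr _ ih => simp_all [Prog.WritesReg]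
  | ite_false hr _ ih => simp_all [Prog.WritesReg]
  | loop_done hr => rfl
  | loop_again hr _ _ ih1 ih2 => simp_all [Prog.WritesReg]
  | guess s r v hv => simp_all [Prog.WritesReg]
  | query s r A a l m b hq hv => simp_all [Prog.WritesReg]

theorem Exec.mem_eq {O : Oracle} {W : ℕ} {p : Prog} {s s' : State} {t : ℕ} {Q : List ℕ}
    (h : Exec O W p s t Q s') {A : ℕ} (hA : ¬ p.WritesArr A) : s'.mem A = s.mem A := by
  induction h with
  | store s A a r hv => funext i; simp_all [Prog.WritesArr]
  | seq _ _ ih1 ih2 => simp_all [Prog.WritesArr]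
  | ite_true hr _ ih => simp_all [Prog.WritesArr]
  | ite_false hr _ ih => simp_all [Prog.WritesArr]
  | loop_again hr _ _ ih1 ih2 => simp_all [Prog.WritesArr]
  | _ => rfl

/-- The program `p` without oracle has a run from `s` to `s'` of at most `c` steps; the words may be
of any size. -/
def Reaches (p : Prog) (s : State) (c : ℕ) (s' : State) : Prop :=
  ∃ W t, t ≤ c ∧ Exec noOracle W p s t [] s'

theorem Reaches.seq {p q : Prog} {s s' s'' : State} {c d : ℕ} (hp : Reaches p s c s')
    (hq : Reaches q s' d s'') : Reaches (.seq p q) s (c + d) s'' := by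
  obtain ⟨W, t, ht, h⟩ := hp
  obtain ⟨W', t', ht', h'⟩ := hq
  exact ⟨max W W', t + t', by omega,
    .seq (h.mono (le_max_left _ _)) (h'.mono (le_max_right _ _))⟩

theorem Reaches.ite_true {r : ℕ} {p q : Prog} {s s' : State} {c : ℕ} (hr : s.reg r ≠ 0)
    (hp : Reaches p s c s') : Reaches (.ite r p q) s (c + 1) s' := by
  obtain ⟨W, t, ht, h⟩ := hp
  exact ⟨W, t + 1, by omega, .ite_true hr h⟩

theorem Reaches.ite_false {r : ℕ} {p q : Prog} {s s' : State} {c : ℕ} (hr : s.reg r = 0)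
    (hp : Reaches q s c s') : Reaches (.ite r p q) s (c + 1) s' := by
  obtain ⟨W, t, ht, h⟩ := hp
  exact ⟨W, t + 1, by omega, .ite_false hr h⟩

theorem Reaches.loop_done {r : ℕ} {p : Prog} {s : State} (hr : s.reg r = 0) :
    Reaches (.loop r p) s 1 s :=
  ⟨0, 1, le_rfl, .loop_done hr⟩

theorem Reaches.loop_again {r : ℕ} {p : Prog} {s s' s'' : State} {c d : ℕ} (hr : s.reg r ≠ 0)
    (hp : Reaches p s c s') (hl : Reaches (.loop r p) s' d s'') :
    Reaches (.loop r p) s (c + d + 1) s'' := by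
  obtain ⟨W, t, ht, h⟩ := hp
  obtain ⟨W', t', ht', h'⟩ := hl
  exact ⟨max W W', t + t' + 1, by omega,
    .loop_again hr (h.mono (le_max_left _ _)) (h'.mono (le_max_right _ _))⟩

theorem Reaches.mono {p : Prog} {s s' : State} {c d : ℕ} (h : Reaches p s c s') (hcd : c ≤ d) :
    Reaches p s d s' := by
  obtain ⟨W, t, ht, h⟩ := h
  exact ⟨W, t, ht.trans hcd, h⟩

theorem Reaches.reg_eq {p : Prog} {s s' : State} {c : ℕ} (h : Reaches p s c s') {r : ℕ}
    (hr : ¬ p.WritesReg r) : s'.reg r = s.reg r := by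
  obtain ⟨W, t, ht, h⟩ := h
  exact h.reg_eq hr

theorem Reaches.mem_eq {p : Prog} {s s' : State} {c : ℕ} (h : Reaches p s c s') {A : ℕ}
    (hA : ¬ p.WritesArr A) : s'.mem A = s.mem A := by
  obtain ⟨W, t, ht, h⟩ := h
  exact h.mem_eq hA

/-- Programs without loops, guesses and queries. -/
def Prog.Straight : Prog → Prop
  | .seq p q => p.Straight ∧ q.Straight
  | .ite _ p q => p.Straight ∧ q.Straight
  | .loop _ _ => False
  | .guess _ => False
  | .query _ _ _ _ => False
  | _ => True

/-- The effect of a straight program on the state; loops, guesses and queries count as `skip`. -/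
def Prog.eval : Prog → State → State
  | .const r v, s => s.setReg r v
  | .op o r a b, s => s.setReg r (o.eval (s.reg a) (s.reg b))
  | .load r A a, s => s.setReg r (s.mem A (s.reg a))
  | .store A a r, s => s.setMem A (s.reg a) (s.reg r)
  | .seq p q, s => q.eval (p.eval s)
  | .ite r p q, s => if s.reg r ≠ 0 then p.eval s else q.eval s
  | _, s => s

/-- A bound on the number of steps of a straight program. -/
def Prog.cost : Prog → ℕ
  | .seq p q => p.cost + q.cost
  | .ite _ p q => p.cost + q.cost + 1
  | _ => 1

theorem Prog.Straight.reaches {p : Prog} (hp : p.Straight) (s : State) :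
    Reaches p s p.cost (p.eval s) := by
  induction p generalizing s with
  | skip => exact ⟨0, 1, le_rfl, .skip s⟩
  | const r v => exact ⟨_, 1, le_rfl, .const s r v le_rfl⟩
  | op o r a b => exact ⟨_, 1, le_rfl, .op s o r a b le_rfl⟩
  | load r A a => exact ⟨_, 1, le_rfl, .load s r A a le_rfl⟩
  | store A a r => exact ⟨_, 1, le_rfl, .store s A a r le_rfl⟩
  | seq p q ihp ihq => exact (ihp hp.1 s).seq (ihq hp.2 _)
  | ite r p q ihp ihq =>
    by_cases hr : s.reg r = 0
    · have := (ihq hp.2 s).ite_false (p := p) hr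
      rw [eval, if_neg (not_not.2 hr)]
      exact this.mono (by simp only [cost]; omega)
    · have := (ihp hp.1 s).ite_true (q := q) hr
      rw [eval, if_pos hr]
      exact this.mono (by simp only [cost]; omega)
  | loop => exact hp.elim
  | guess => exact hp.elim
  | query => exact hp.elim

/-! ### Programs that produce no large words -/

/-- All words of the state `s` are at most `B`. -/
def State.Bounded (s : State) (B : ℕ) : Prop :=
  (∀ r, s.reg r ≤ B) ∧ ∀ A i, s.mem A i ≤ B

theorem State.Bounded.mono {s : State} {B B' : ℕ} (h : s.Bounded B) (hB : B ≤ B') :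
    s.Bounded B' :=
  ⟨fun r => (h.1 r).trans hB, fun A i => (h.2 A i).trans hB⟩

theorem State.Bounded.setReg {s : State} {B : ℕ} (h : s.Bounded B) (r : ℕ) {v : ℕ} (hv : v ≤ B) :
    (s.setReg r v).Bounded B := by
  refine ⟨fun r' => ?_, h.2⟩
  rw [State.setReg_reg]
  split_ifs
  exacts [hv, h.1 r']

theorem State.Bounded.setMem {s : State} {B : ℕ} (h : s.Bounded B) (A i : ℕ) {v : ℕ} (hv : v ≤ B) :
    (s.setMem A i v).Bounded B := by
  refine ⟨h.1, fun A' i' => ?_⟩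
  rw [State.setMem_mem]
  split_ifs
  exacts [hv, h.2 A' i']

/-- The largest word in use grows by at most one per step. A run of such a program, whatever its
word bound, is also a run with a word bound given by its starting state and its running time.
(`4` exceeds the constants that occur in the programs below.) -/
def Tame (p : Prog) : Prop :=
  ∀ ⦃W : ℕ⦄ ⦃s : State⦄ ⦃t : ℕ⦄ ⦃Q : List ℕ⦄ ⦃s' : State⦄, Exec noOracle W p s t Q s' →
    ∀ ⦃B : ℕ⦄, 4 ≤ B → s.Bounded B → Exec noOracle (B + t) p s t Q s' ∧ s'.Bounded (B + t)

theorem tame_skip : Tame .skip := by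
  intro W s t Q s' h B hB hs
  cases h
  exact ⟨.skip _, hs.mono (by omega)⟩

theorem tame_const (r : ℕ) {v : ℕ} (hv : v ≤ 4) : Tame (.const r v) := by
  intro W s t Q s' h B hB hs
  cases h
  exact ⟨.const _ _ _ (by omega), (hs.mono (by omega)).setReg _ (by omega)⟩

/-- The operations whose value is at most their first argument. -/
theorem tame_op {o : BinOp} (ho : ∀ a b, o.eval a b ≤ a) (r a b : ℕ) : Tame (.op o r a b) := by
  intro W s t Q s' h B hB hs
  cases h
  have h1 := (ho (s.reg a) (s.reg b)).trans (hs.1 a)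
  exact ⟨.op _ _ _ _ _ (by omega), (hs.mono (by omega)).setReg _ (by omega)⟩

theorem tame_load (r A a : ℕ) : Tame (.load r A a) := by
  intro W s t Q s' h B hB hs
  cases h
  have h1 := hs.2 A (s.reg a)
  exact ⟨.load _ _ _ _ (by omega), (hs.mono (by omega)).setReg _ (by omega)⟩

theorem tame_store (A a r : ℕ) : Tame (.store A a r) := by
  intro W s t Q s' h B hB hs
  cases h
  have h1 := hs.1 r
  exact ⟨.store _ _ _ _ (by omega), (hs.mono (by omega)).setMem _ _ (by omega)⟩

theorem Tame.seq {p q : Prog} (hp : Tame p) (hq : Tame q) : Tame (.seq p q) := by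
  intro W s t Q s' h B hB hs
  cases h with
  | @seq _ _ _ s₁ _ t₁ t₂ Q₁ Q₂ h1 h2 =>
    obtain ⟨e1, b1⟩ := hp h1 hB hs
    obtain ⟨e2, b2⟩ := hq h2 (by omega) b1
    rw [← Nat.add_assoc]
    exact ⟨.seq (e1.mono (by omega)) e2, b2⟩

theorem Tame.ite {p q : Prog} (r : ℕ) (hp : Tame p) (hq : Tame q) : Tame (.ite r p q) := by
  intro W s t Q s' h B hB hs
  cases h with
  | ite_true hr h1 =>
    obtain ⟨e1, b1⟩ := hp h1 hB hs
    exact ⟨.ite_true hr (e1.mono (by omega)), b1.mono (by omega)⟩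
  | ite_false hr h1 =>
    obtain ⟨e1, b1⟩ := hq h1 hB hs
    exact ⟨.ite_false hr (e1.mono (by omega)), b1.mono (by omega)⟩

theorem Tame.loop {p : Prog} (r : ℕ) (hp : Tame p) : Tame (.loop r p) := by
  intro W s t Q s' h
  generalize hq : Prog.loop r p = q at h
  induction h with
  | loop_done hr =>
    cases hq
    intro B hB hs
    exact ⟨.loop_done hr, hs.mono (by omega)⟩
  | loop_again hr h1 h2 _ ih =>
    cases hq
    intro B hB hs
    obtain ⟨e1, b1⟩ := hp h1 hB hs
    obtain ⟨e2, b2⟩ := ih rfl (by omega) b1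
    exact ⟨.loop_again hr (e1.mono (by omega)) (e2.mono (by omega)), b2.mono (by omega)⟩
  | _ => cases hq

/-- `reg r := reg a`. -/
def mov (r a : ℕ) : Prog := .op .land r a a

/-- `reg r := reg r + 1`; register `9` is overwritten. -/
def inc (r : ℕ) : Prog := .seq (.const 9 1) (.op .add r r 9)

/-- `reg r := reg r - c`; register `9` is overwritten. -/
def dec (r c : ℕ) : Prog := .seq (.const 9 c) (.op .sub r r 9)

theorem tame_sub (r a b : ℕ) : Tame (.op .sub r a b) := 
  tame_op (o := .sub) Nat.sub_le r a b

theorem tame_mod (r a b : ℕ) : Tame (.op .mod r a b) := 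
  tame_op (o := .mod) Nat.mod_le r a b

theorem tame_mov (r a : ℕ) : Tame (mov r a) := tame_op (fun _ _ => Nat.and_le_left) r a a

theorem tame_dec (r : ℕ) {c : ℕ} (hc : c ≤ 4) : Tame (dec r c) :=
  (tame_const 9 hc).seq (tame_sub r r 9)

theorem tame_inc (r : ℕ) : Tame (inc r) := by
  intro W s t Q s' h B hB hs
  cases h with
  | seq h1 h2 =>
    cases h1
    cases h2
    have hv : BinOp.add.eval ((s.setReg 9 1).reg r) ((s.setReg 9 1).reg 9) ≤ B + 1 := by
      have := hs.1 r
      simp only [BinOp.eval, State.setReg_reg]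
      split_ifs <;> omega
    exact ⟨.seq (.const _ _ _ (by omega)) (.op _ _ _ _ _ (by omega)),
      ((hs.mono (by omega)).setReg _ (by omega)).setReg _ (by omega)⟩

/-! ### Lock-set races and lock holders -/

/-- The code of the operation of an event: read `0`, write `1`, acquire `2`, release `3`. -/
def Event.opCode (e : Event) : ℕ :=
  match e.op with
  | .read _ => 0
  | .write _ => 1
  | .acq _ => 2
  | .rel _ => 3

/-- The variable or lock on which an event operates. -/
def Event.arg (e : Event) : ℕ :=
  match e.op with
  | .read x => x
  | .write x => x
  | .acq l => l
  | .rel l => l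

theorem Event.code_eq (e : Event) : e.code = [e.thread, e.opCode, e.arg] := by
  rcases e with ⟨t, _ | _ | _ | _⟩ <;> rfl

/-- The event `e` reads or writes the variable `x`. -/
def Event.Accesses (e : Event) (x : ℕ) : Prop := e.op = .read x ∨ e.op = .write x

theorem Event.Accesses.arg_eq {e : Event} {x : ℕ} (h : e.Accesses x) : e.arg = x := by
  rcases h with h | h <;> simp [Event.arg, h]

/-- The change of the lock holders by the event `e`, with the encoding of `holder`. -/
def holderStep (h : ℕ → ℕ) (e : Event) : ℕ → ℕ :=
  match e.op with
  | .acq l => Function.update h l (e.thread + 1)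
  | .rel l => Function.update h l 0
  | _ => h

theorem holderStep_acq (h : ℕ → ℕ) (t l : ℕ) :
    holderStep h ⟨t, .acq l⟩ = Function.update h l (t + 1) := rfl

theorem holderStep_rel (h : ℕ → ℕ) (t l : ℕ) :
    holderStep h ⟨t, .rel l⟩ = Function.update h l 0 := rfl

/-- After the events `es`, the lock `l` is held by thread `t` if `holder es l = t + 1`, and is free
if `holder es l = 0`. -/
def holder (es : List Event) : ℕ → ℕ := es.foldl holderStep fun _ => 0

@[simp] theorem holder_nil (l : ℕ) : holder [] l = 0 := rfl

@[simp] theorem holder_snoc (es : List Event) (e : Event) :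
    holder (es ++ [e]) = holderStep (holder es) e := by
  simp [holder]

theorem holder_eq_zero_or (es : List Event) (l : ℕ) :
    holder es l = 0 ∨
      (∃ e ∈ es, e.arg = l) ∧ ∃ e ∈ es, holder es l = e.thread + 1 := by
  induction es using List.reverseRecOn with
  | nil => exact .inl rfl
  | append_singleton es e ih =>
    have key : holder es l = 0 ∨ (∃ f ∈ es ++ [e], f.arg = l) ∧
        ∃ f ∈ es ++ [e], holder es l = f.thread + 1 := by
      refine ih.imp id fun h => ⟨?_, ?_⟩
      · obtain ⟨f, hf, h⟩ := h.1
        exact ⟨f, by simp [hf], h⟩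
      · obtain ⟨f, hf, h⟩ := h.2
        exact ⟨f, by simp [hf], h⟩
    rw [holder_snoc]
    rcases e with ⟨t, x | x | l' | l'⟩
    · exact key
    · exact key
    · by_cases hl : l = l'
      · subst hl
        exact .inr ⟨⟨⟨t, .acq l⟩, by simp, rfl⟩, ⟨t, .acq l⟩, by simp, by simp [holderStep]⟩
      · simpa [holderStep, hl] using key
    · by_cases hl : l = l'
      · subst hl
        exact .inl (by simp [holderStep])
      · simpa [holderStep, hl] using key

theorem holder_take_eq_succ_iff (es : List Event) (l t n : ℕ) (hn : n ≤ es.length) :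
    holder (es.take n) l = t + 1 ↔ ∃ (i : ℕ) (hi : i < n), es[i] = ⟨t, .acq l⟩ ∧
      ∀ (j : ℕ) (hj : j < n), i < j → es[j].op ≠ .acq l ∧ es[j].op ≠ .rel l := by
  induction n with
  | zero => simp
  | succ n ih =>
    specialize ih (by omega)
    rw [List.take_succ_eq_append_getElem (by omega), holder_snoc]
    have key : (es[n].op ≠ .acq l ∧ es[n].op ≠ .rel l) →
        (holder (es.take n) l = t + 1 ↔ ∃ (i : ℕ) (hi : i < n + 1), es[i] = ⟨t, .acq l⟩ ∧
          ∀ (j : ℕ) (hj : j < n + 1), i < j → es[j].op ≠ .acq l ∧ es[j].op ≠ .rel l) := by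
      intro hne
      rw [ih]
      constructor
      · rintro ⟨i, hi, h1, h2⟩
        refine ⟨i, by omega, h1, fun j hj hij => ?_⟩
        rcases Nat.lt_succ_iff_lt_or_eq.1 hj with h | h
        · exact h2 j h hij
        · subst h; exact hne
      · rintro ⟨i, hi, h1, h2⟩
        rcases Nat.lt_succ_iff_lt_or_eq.1 hi with h | h
        · exact ⟨i, h, h1, fun j hj hij => h2 j (by omega) hij⟩
        · subst h
          exact absurd (by rw [h1]) hne.1
    rcases he : es[n] with ⟨u, x | x | l' | l'⟩
    · exact key (by simp [he])
    · exact key (by simp [he])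
    · by_cases hl : l = l'
      · subst hl
        simp only [holderStep, Function.update_self, Nat.add_right_cancel_iff]
        constructor
        · rintro rfl
          exact ⟨n, by omega, he, fun j hj hij => by omega⟩
        · rintro ⟨i, hi, h1, h2⟩
          rcases Nat.lt_succ_iff_lt_or_eq.1 hi with h | h
          · exact absurd (by rw [he]) (h2 n (by omega) h).1
          · subst h
            rw [he] at h1
            simpa using h1
      · rw [holderStep_acq, Function.update_of_ne hl]
        exact key (by simp [he, Ne.symm hl])
    · by_cases hl : l = l'
      · subst hl
        simp only [holderStep, Function.update_self]
        constructor
        · intro h; omega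
        · rintro ⟨i, hi, h1, h2⟩
          rcases Nat.lt_succ_iff_lt_or_eq.1 hi with h | h
          · exact absurd (by rw [he]) (h2 n (by omega) h).2
          · subst h
            rw [he] at h1
            simp at h1
      · rw [holderStep_rel, Function.update_of_ne hl]
        exact key (by simp [he, Ne.symm hl])

theorem eq_rel_of_prefix_blocks {l t : ℕ} {g : Event} {C : List Event} {ts : List ℕ}
    {A : List Event}
    (h : A ++ ⟨t, .acq l⟩ :: g :: C <+: ts.flatMap fun t => [⟨t, .acq l⟩, ⟨t, .rel l⟩]) :
    g = ⟨t, .rel l⟩ := by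
  induction ts generalizing A with
  | nil => simp at h
  | cons u ts ih =>
    rw [List.flatMap_cons] at h
    match A, h with
    | [], h =>
      simp only [List.nil_append, List.cons_append, List.cons_prefix_cons, Event.mk.injEq,
        and_true] at h
      rw [h.2.1, h.1]
    | [a], h =>
      simp [List.cons_prefix_cons] at h
    | a :: b :: A, h =>
      simp only [List.cons_append, List.cons_prefix_cons, List.nil_append] at h
      exact ih h.2.2

/-- In a well-formed trace, the first event on `l` after an acquire event on `l` is the
release event of the same thread. -/
theorem Trace.eq_rel_of_acq (σ : Trace) {l t i j : ℕ} (hj : j < σ.events.length) (hij : i < j)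
    (hi : σ.events[i] = ⟨t, .acq l⟩)
    (hjl : σ.events[j].op = .acq l ∨ σ.events[j].op = .rel l)
    (hb : ∀ (k : ℕ) (hk : k < j), i < k → σ.events[k].op ≠ .acq l ∧ σ.events[k].op ≠ .rel l) :
    σ.events[j] = ⟨t, .rel l⟩ := by
  obtain ⟨ts, hts⟩ := σ.wellFormed l
  have hsplit : σ.events = σ.events.take i ++ (σ.events[i] ::
      ((σ.events.drop (i + 1)).take (j - (i + 1)) ++ σ.events[j] :: σ.events.drop (j + 1))) := by
    rw [← List.drop_eq_getElem_cons hj]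
    have : σ.events.drop j = (σ.events.drop (i + 1)).drop (j - (i + 1)) := by
      rw [List.drop_drop]; congr 1; omega
    rw [this, List.take_append_drop, ← List.drop_eq_getElem_cons, List.take_append_drop]
  have hmid : lockProj ((σ.events.drop (i + 1)).take (j - (i + 1))) l = [] := by
    rw [lockProj, List.filter_eq_nil_iff]
    intro e he
    obtain ⟨k, hk, rfl⟩ := List.getElem_of_mem he
    rw [List.length_take, List.length_drop] at hk
    rw [List.getElem_take, List.getElem_drop]
    have := hb (i + 1 + k) (by omega) (by omega)
    simp [this]
  rw [hsplit, hi] at hts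
  simp only [lockProj, List.filter_append, List.filter_cons] at hts hmid
  rw [hmid] at hts
  simp only [hjl, decide_true, if_true, List.nil_append, true_or] at hts
  exact eq_rel_of_prefix_blocks hts

theorem Trace.mem_locksHeld_iff (σ : Trace) (e : σ.Ev) {x : ℕ}
    (hx : (σ.events.get e).Accesses x) (l : ℕ) :
    l ∈ σ.locksHeld e ↔ holder (σ.events.take e) l = (σ.events.get e).thread + 1 := by
  rw [holder_take_eq_succ_iff _ _ _ _ e.2.le]
  constructor
  · rintro ⟨f, hf, ⟨hfe, hth⟩, hm⟩
    have hf' : σ.events[(f : ℕ)] = ⟨(σ.events.get e).thread, .acq l⟩ := by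
      apply Event.ext
      · exact hth
      · exact hf
    have hne : f ≠ e := by
      rintro rfl
      simp only [List.get_eq_getElem] at hx
      rw [Event.Accesses, hf'] at hx
      simp at hx
    have hlt : (f : ℕ) < e := lt_of_le_of_ne hfe (fun h => hne (Fin.ext h))
    refine ⟨f, hlt, hf', ?_⟩
    by_contra hcon
    push Not at hcon
    -- the first event on `l` after `f` is the matching release, which cannot precede `e`
    have hex : ∃ j : ℕ, ∃ hj : j < e, (f : ℕ) < j ∧
        (σ.events[j].op = .acq l ∨ σ.events[j].op = .rel l) := by
      obtain ⟨j, hj, hfj, h⟩ := hcon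
      exact ⟨j, hj, hfj, by tauto⟩
    classical
    obtain ⟨hj, hfj, hjl⟩ := Nat.find_spec hex
    set j := Nat.find hex
    have hbet : ∀ (k : ℕ) (hk : k < j), (f : ℕ) < k →
        σ.events[k].op ≠ .acq l ∧ σ.events[k].op ≠ .rel l := by
      intro k hk hfk
      have := Nat.find_min hex hk
      by_contra h
      exact this ⟨by omega, hfk, by tauto⟩
    have hjeq := σ.eq_rel_of_acq (by omega) hfj hf' hjl hbet
    have hmatch : σ.IsMatch l f ⟨j, by omega⟩ := by
      refine ⟨hfj, ?_, hf, ?_, ?_⟩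
      · simp only [Trace.thread, List.get_eq_getElem, hjeq, hf']
      · simp only [Trace.op, List.get_eq_getElem, hjeq]
      · intro g hg1 hg2
        exact hbet g hg2 hg1
    have := (hm _ hmatch).1
    rw [Fin.le_def] at this
    simp only at this
    omega
  · rintro ⟨i, hi, h1, h2⟩
    refine ⟨⟨i, by omega⟩, ?_, ⟨?_, ?_⟩, ?_⟩
    · simp [Trace.op, h1]
    · exact hi.le
    · simp [Trace.thread, h1]
    · rintro m ⟨hm1, hm2, hm3, hm4, -⟩
      refine ⟨?_, ?_⟩
      · by_contra hlt
        push Not at hlt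
        exact (h2 m hlt hm1).2 hm4
      · rw [← hm2]
        simp [Trace.thread, h1]

/-- Some access of `x` in `es` is made by a thread that does not hold `l` at that time. -/
def Unprotected (es : List Event) (x l : ℕ) : Prop :=
  ∃ pre e post, es = pre ++ e :: post ∧ e.Accesses x ∧ holder pre l ≠ e.thread + 1

theorem forall_split_snoc {α : Type*} {es : List α} {e : α} {P : List α → α → Prop} :
    (∀ pre f post, es ++ [e] = pre ++ f :: post → P pre f) ↔
      (∀ pre f post, es = pre ++ f :: post → P pre f) ∧ P es e := by
  constructor
  · refine fun h => ⟨fun pre f post heq => h pre f (post ++ [e]) (by simp [heq]), h es e [] rfl⟩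
  · rintro ⟨h1, h2⟩ pre f post heq
    rcases List.eq_nil_or_concat post with rfl | ⟨post, b, rfl⟩
    · obtain ⟨rfl, h⟩ := List.append_inj' heq rfl
      cases h
      exact h2
    · rw [List.concat_eq_append, ← List.cons_append, ← List.append_assoc] at heq
      exact h1 pre f post (List.append_inj' heq rfl).1

theorem not_unprotected_iff {es : List Event} {x l : ℕ} : ¬ Unprotected es x l ↔
    ∀ pre e post, es = pre ++ e :: post → e.Accesses x → holder pre l = e.thread + 1 := by
  simp only [Unprotected]
  push Not
  rfl

theorem unprotected_nil (x l : ℕ) : ¬ Unprotected [] x l := by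
  rintro ⟨pre, e, post, h, -⟩
  simp at h

theorem unprotected_snoc {es : List Event} {e : Event} {x l : ℕ} :
    Unprotected (es ++ [e]) x l ↔
      Unprotected es x l ∨ e.Accesses x ∧ holder es l ≠ e.thread + 1 := by
  rw [← not_iff_not, not_or, not_unprotected_iff, not_unprotected_iff,
    forall_split_snoc (P := fun pre e => e.Accesses x → holder pre l = e.thread + 1)]
  tauto

theorem Trace.mem_accesses_iff (σ : Trace) (e : σ.Ev) (x : ℕ) :
    e ∈ σ.accesses x ↔ (σ.events.get e).Accesses x := Iff.rfl

theorem Trace.hasLockSetRaceOn_iff (σ : Trace) (x : ℕ) :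
    σ.HasLockSetRaceOn x ↔
      (∃ e ∈ σ.events, ∃ f ∈ σ.events, e.op = .write x ∧ f.Accesses x ∧ f.thread ≠ e.thread) ∧
        ∀ l, Unprotected σ.events x l := by
  refine and_congr ?_ ?_
  · constructor
    · rintro ⟨e, he, f, hf, hne, -⟩
      exact ⟨_, List.get_mem _ e, _, List.get_mem _ f, he, hf, Ne.symm hne⟩
    · rintro ⟨e, he, f, hf, h1, h2, h3⟩
      obtain ⟨i, rfl⟩ := List.mem_iff_get.1 he
      obtain ⟨j, rfl⟩ := List.mem_iff_get.1 hf
      exact ⟨i, h1, j, h2, Ne.symm h3, x, .inr h1, h2, .inl h1⟩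
  · rw [Set.eq_empty_iff_forall_notMem]
    refine forall_congr' fun l => ?_
    simp only [Set.mem_iInter, not_forall]
    constructor
    · rintro ⟨e, he, hl⟩
      rw [σ.mem_locksHeld_iff e he] at hl
      refine ⟨σ.events.take e, σ.events.get e, σ.events.drop (e + 1), ?_, he, hl⟩
      rw [List.get_eq_getElem, ← List.drop_eq_getElem_cons, List.take_append_drop]
    · rintro ⟨pre, e, post, heq, he, hl⟩
      have hlen : pre.length < σ.events.length := by simp [heq]
      have hget : σ.events.get ⟨pre.length, hlen⟩ = e := by simp [heq]
      refine ⟨⟨pre.length, hlen⟩, by rw [mem_accesses_iff, hget]; exact he, ?_⟩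
      rw [σ.mem_locksHeld_iff _ (by rw [hget]; exact he), hget]
      simpa [heq] using hl

/-! ### Certificates for the absence of races -/

/-- The label `(k, v)` of a variable explains why an access event `e` of it is not in a race: the
variable is never written (`k = 0`), or only thread `v` accesses it (`k = 1`), or lock `v` protects
it (`k ≥ 2`). Here `h` gives the lock holders at the time of `e`, as in `holder`. -/
def LabelOk (k v : ℕ) (h : ℕ → ℕ) (e : Event) : Prop :=
  if k = 0 then e.opCode = 0 else if k = 1 then v = e.thread else h v = e.thread + 1

/-- The labels `K`, `V` of the variables explain all accesses in `es`. -/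
def Explained (K V : ℕ → ℕ) (es : List Event) : Prop :=
  ∀ pre e post, es = pre ++ e :: post → e.opCode ≤ 1 → LabelOk (K e.arg) (V e.arg) (holder pre) e

theorem explained_nil (K V : ℕ → ℕ) : Explained K V [] := by
  intro pre e post h
  simp at h

theorem explained_snoc {K V : ℕ → ℕ} {es : List Event} {e : Event} :
    Explained K V (es ++ [e]) ↔
      Explained K V es ∧ (e.opCode ≤ 1 → LabelOk (K e.arg) (V e.arg) (holder es) e) :=
  forall_split_snoc
    (P := fun pre (e : Event) => e.opCode ≤ 1 → LabelOk (K e.arg) (V e.arg) (holder pre) e)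

theorem Event.Accesses.opCode_le {e : Event} {x : ℕ} (h : e.Accesses x) : e.opCode ≤ 1 := by
  rcases h with h | h <;> simp [Event.opCode, h]

theorem Event.accesses_of_opCode_le {e : Event} (h : e.opCode ≤ 1) : e.Accesses e.arg := by
  rcases e with ⟨t, _ | _ | _ | _⟩ <;> simp_all [Event.opCode, Event.Accesses, Event.arg]

theorem Trace.not_hasLockSetRace_of_explained {σ : Trace} {K V : ℕ → ℕ}
    (h : Explained K V σ.events) : ¬ σ.HasLockSetRace := by
  rintro ⟨x, hx⟩
  obtain ⟨⟨e, he, f, hf, hew, hfa, hne⟩, hl⟩ := (σ.hasLockSetRaceOn_iff x).1 hx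
  have hea : e.Accesses x := .inr hew
  have key : ∀ g ∈ σ.events, g.Accesses x → ∃ pre, LabelOk (K x) (V x) (holder pre) g := by
    intro g hg hgx
    obtain ⟨pre, post, heq⟩ := List.append_of_mem hg
    have := h pre g post heq hgx.opCode_le
    rw [hgx.arg_eq] at this
    exact ⟨pre, this⟩
  obtain ⟨p1, h1⟩ := key e he hea
  obtain ⟨p2, h2⟩ := key f hf hfa
  simp only [LabelOk] at h1 h2
  split_ifs at h1 h2 with hK0 hK1
  · simp [Event.opCode, hew] at h1
  · omega
  · obtain ⟨pre, g, post, heq, hg, hgl⟩ := hl (V x)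
    have := h pre g post heq hg.opCode_le
    rw [hg.arg_eq, LabelOk, if_neg hK0, if_neg hK1] at this
    exact hgl this

/-- A trace without races has labels that explain all accesses, and all labels are small or occur
in the trace. -/
theorem Trace.exists_explained {σ : Trace} (h : ¬ σ.HasLockSetRace) :
    ∃ K V : ℕ → ℕ, Explained K V σ.events ∧ (∀ x, K x ≤ 2) ∧
      ∀ x, V x = 0 ∨ ∃ e ∈ σ.events, V x = e.thread ∨ V x = e.arg := by
  have key : ∀ x, ∃ k v : ℕ, k ≤ 2 ∧ (v = 0 ∨ ∃ e ∈ σ.events, v = e.thread ∨ v = e.arg) ∧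
      ∀ pre e post, σ.events = pre ++ e :: post → e.Accesses x → LabelOk k v (holder pre) e := by
    intro x
    have hx : ¬ σ.HasLockSetRaceOn x := fun hx => h ⟨x, hx⟩
    rw [σ.hasLockSetRaceOn_iff, not_and_or] at hx
    by_cases hw : ∃ e ∈ σ.events, e.op = .write x
    · obtain ⟨e, he, hew⟩ := hw
      rcases hx with hx | hx
      · refine ⟨1, e.thread, by omega, .inr ⟨e, he, .inl rfl⟩, fun pre f post heq hf => ?_⟩
        by_contra hne
        refine hx ⟨e, he, f, by simp [heq], hew, hf, fun h => hne ?_⟩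
        simp [LabelOk, h]
      · push Not at hx
        obtain ⟨l, hl⟩ := hx
        rw [not_unprotected_iff] at hl
        obtain ⟨pre, post, heq⟩ := List.append_of_mem he
        have h1 := hl pre e post heq (.inr hew)
        rcases holder_eq_zero_or pre l with h0 | ⟨⟨f, hf, hfl⟩, -⟩
        · omega
        · refine ⟨2, l, le_rfl, .inr ⟨f, by simp [heq, hf], .inr hfl.symm⟩, ?_⟩
          intro pre f post heq hf
          simp [LabelOk, hl pre f post heq hf]
    · refine ⟨0, 0, by omega, .inl rfl, fun pre f post heq hf => ?_⟩
      rcases hf with hf | hf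
      · simp [LabelOk, Event.opCode, hf]
      · exact absurd ⟨f, by simp [heq], hf⟩ hw
  choose K V hK hV h using key
  exact ⟨K, V, fun pre e post heq he => h _ pre e post heq (Event.accesses_of_opCode_le he), hK, hV⟩

/-! ### Passing over the events of a trace -/

/-- Registers `3`, `4`, `5` receive the thread, operation code and argument of the event that stands
in array `A` at the address in register `1`; the address advances, and the number of remaining words
in register `2` drops. -/
def fetch (A : ℕ) : Prog :=
  .seq (.load 3 A 1) (.seq (inc 1) (.seq (.load 4 A 1) (.seq (inc 1)
    (.seq (.load 5 A 1) (.seq (inc 1) (dec 2 3))))))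

/-- Runs `body` for each event of the block of array `A` with address in register `17` and length in
register `18`. -/
def forEvents (A : ℕ) (body : Prog) : Prog :=
  .seq (mov 1 17) (.seq (mov 2 18) (.loop 2 (.seq (fetch A) body)))

theorem State.block_succ (s : State) (A i n : ℕ) :
    s.block A i (n + 1) = s.mem A i :: s.block A (i + 1) n := by
  simp [State.block, List.range_succ_eq_map, Nat.add_assoc, Nat.add_comm 1]

theorem length_eventsCode (es : List Event) : (eventsCode es).length = 3 * es.length := by
  induction es with
  | nil => rfl
  | cons e es ih =>
    have : eventsCode (e :: es) = e.code ++ eventsCode es := rfl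
    rw [this, List.length_append, ih, Event.code_eq]
    simp; omega

theorem State.length_block (s : State) (A i n : ℕ) : (s.block A i n).length = n := by
  simp [State.block]

theorem reaches_loop_events {A : ℕ} {body : Prog} (hb : body.Straight)
    (hw1 : ¬ body.WritesReg 1) (hw2 : ¬ body.WritesReg 2) (hA : ¬ body.WritesArr A)
    {I : List Event → State → Prop}
    (hI : ∀ es s s', (∀ r, 10 ≤ r → s'.reg r = s.reg r) → s'.mem = s.mem → I es s → I es s')
    (full : List Event)
    (hstep : ∀ pre e post s, full = pre ++ e :: post → I pre s → s.reg 3 = e.thread →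
      s.reg 4 = e.opCode → s.reg 5 = e.arg → I (pre ++ [e]) (body.eval s))
    (post : List Event) : ∀ (pre : List Event) (s : State), full = pre ++ post →
      s.block A (s.reg 1) (s.reg 2) = eventsCode post → I pre s →
      ∃ s', Reaches (.loop 2 (.seq (fetch A) body)) s ((body.cost + 12) * post.length + 1) s' ∧
        I full s' := by
  induction post with
  | nil =>
    intro pre s hfull hblock hs
    have h2 : s.reg 2 = 0 := by
      rw [← s.length_block A (s.reg 1) (s.reg 2), hblock]; rfl
    rw [List.append_nil] at hfull
    exact ⟨s, (Reaches.loop_done h2).mono (by simp), hfull ▸ hs⟩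
  | cons e post ih =>
    intro pre s hfull hblock hs
    have h2 : s.reg 2 = 3 * post.length + 3 := by
      rw [← s.length_block A (s.reg 1) (s.reg 2), hblock, length_eventsCode, List.length_cons]
      ring
    have hcons : eventsCode (e :: post) = e.code ++ eventsCode post := rfl
    rw [h2, State.block_succ, State.block_succ, State.block_succ, hcons, Event.code_eq] at hblock
    simp only [List.cons_append, List.nil_append, List.cons.injEq] at hblock
    obtain ⟨h3, h4, h5, hrest⟩ := hblock
    have hfetch : (fetch A).Straight := by simp [fetch, inc, dec, Prog.Straight]
    set s₁ := (fetch A).eval s with hs₁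
    have e3 : s₁.reg 3 = e.thread := by
      simp [hs₁, fetch, inc, dec, Prog.eval, BinOp.eval, h3]
    have e4 : s₁.reg 4 = e.opCode := by
      simp [hs₁, fetch, inc, dec, Prog.eval, BinOp.eval, h4]
    have e5 : s₁.reg 5 = e.arg := by
      simp [hs₁, fetch, inc, dec, Prog.eval, BinOp.eval, h5]
    have e1 : s₁.reg 1 = s.reg 1 + 1 + 1 + 1 := by
      simp [hs₁, fetch, inc, dec, Prog.eval, BinOp.eval]
    have e2 : s₁.reg 2 = 3 * post.length := by
      simp [hs₁, fetch, inc, dec, Prog.eval, BinOp.eval, h2]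
    have em : s₁.mem = s.mem := by
      simp [hs₁, fetch, inc, dec, Prog.eval]
    have hI₁ : I pre s₁ := by
      refine hI pre s s₁ (fun r hr => ?_) em hs
      exact (hfetch.reaches s).reg_eq (by simp [fetch, inc, dec, Prog.WritesReg]; omega)
    have hr₂ := hb.reaches s₁
    have hI₂ := hstep pre e post s₁ hfull hI₁ e3 e4 e5
    obtain ⟨s', hs', hI'⟩ := ih (pre ++ [e]) (body.eval s₁) (by simp [hfull]) (by
      rw [hr₂.reg_eq hw1, hr₂.reg_eq hw2, e1, e2, ← hrest]
      simp only [State.block, hr₂.mem_eq hA, em]) hI₂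
    refine ⟨s', ?_, hI'⟩
    refine (Reaches.loop_again (by omega) ((hfetch.reaches s).seq hr₂) hs').mono ?_
    simp only [fetch, inc, dec, Prog.cost, List.length_cons]
    ring_nf
    omega

/-- The rule for loops over events. The assertion `I pre s` says that `s` is a correct state
after the events `pre`; it must not depend on the registers below `10`. -/
theorem reaches_forEvents {A : ℕ} {body : Prog} (hb : body.Straight)
    (hw1 : ¬ body.WritesReg 1) (hw2 : ¬ body.WritesReg 2) (hA : ¬ body.WritesArr A)
    {I : List Event → State → Prop}
    (hI : ∀ es s s', (∀ r, 10 ≤ r → s'.reg r = s.reg r) → s'.mem = s.mem → I es s → I es s')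
    (full : List Event)
    (hstep : ∀ pre e post s, full = pre ++ e :: post → I pre s → s.reg 3 = e.thread →
      s.reg 4 = e.opCode → s.reg 5 = e.arg → I (pre ++ [e]) (body.eval s))
    (s : State) (hblock : s.block A (s.reg 17) (s.reg 18) = eventsCode full) (h0 : I [] s) :
    ∃ s', Reaches (forEvents A body) s ((body.cost + 12) * full.length + 3) s' ∧ I full s' := by
  have h1 : (mov 1 17).Straight := trivial
  have h2 : (mov 2 18).Straight := trivial
  obtain ⟨s', hs', hI'⟩ := reaches_loop_events hb hw1 hw2 hA hI full hstep full []
    ((mov 2 18).eval ((mov 1 17).eval s)) rfl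
    (by rw [← hblock]; simp [State.block, mov, Prog.eval, BinOp.eval])
    (hI [] s _ (fun r hr => by
      simp [mov, Prog.eval, show r ≠ 1 by omega, show r ≠ 2 by omega]) rfl h0)
  refine ⟨s', ((h1.reaches s).seq ((h2.reaches _).seq hs')).mono ?_, hI'⟩
  simp only [mov, Prog.cost]
  omega

theorem tame_forEvents (A : ℕ) {body : Prog} (hb : Tame body) : Tame (forEvents A body) := by
  refine (tame_mov _ _).seq ((tame_mov _ _).seq (Tame.loop _ (Tame.seq ?_ hb)))
  exact (tame_load _ _ _).seq ((tame_inc _).seq ((tame_load _ _ _).seq ((tame_inc _).seq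
    ((tame_load _ _ _).seq ((tame_inc _).seq (tame_dec _ (by norm_num)))))))

theorem forEvents_writesReg {A : ℕ} {body : Prog} {r : ℕ} (hb : ¬ body.WritesReg r)
    (hr : 10 ≤ r) : ¬ (forEvents A body).WritesReg r := by
  simp [forEvents, fetch, mov, inc, dec, Prog.WritesReg, hb]
  omega

theorem forEvents_writesArr {A : ℕ} {body : Prog} {A' : ℕ} (hb : ¬ body.WritesArr A') :
    ¬ (forEvents A body).WritesArr A' := by
  simp [forEvents, fetch, mov, inc, dec, Prog.WritesArr, hb]

/-! ### The verification of answers to race queries -/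

/-!
The verifier uses these registers and arrays.
* Register `10` is the claimed answer. If it is nonzero, register `11` is the variable of the race,
  and register `12` is a thread that writes it.
* Registers `13` and `14` record whether thread `reg 12` has written variable `reg 11`, and whether
  another thread has accessed it; register `15` counts the accesses to it.
* Register `16` is the verdict.
* Registers `17` and `18` are the address and the length of the query.
* Array `1` contains the lock holders, arrays `2` and `3` the labels of the variables. Cell `t + 1`
  of array `4` counts the accesses of thread `t` to variable `reg 11`. Arrays `5` and `6` belong to
  the search for unprotected accesses, see `RaceInv`.
-/

/-- If `reg a = reg b` then `p` else `q`; register `6` is overwritten first, then register `7`. -/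
def ifEq (a b : ℕ) (p q : Prog) : Prog :=
  .seq (.op .sub 6 a b) (.seq (.op .sub 7 b a) (.ite 6 q (.ite 7 q p)))

theorem eval_ifEq {a b : ℕ} (ha : a ≠ 6) (hb : b ≠ 6) (p q : Prog) (s : State) :
    (ifEq a b p q).eval s =
      if s.reg a = s.reg b then p.eval ((s.setReg 6 0).setReg 7 0)
      else q.eval ((s.setReg 6 (s.reg a - s.reg b)).setReg 7 (s.reg b - s.reg a)) := by
  rcases lt_trichotomy (s.reg a) (s.reg b) with h | h | h
  · have h1 : s.reg a - s.reg b = 0 := by omega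
    have h2 : s.reg b - s.reg a ≠ 0 := by omega
    simp [ifEq, Prog.eval, BinOp.eval, ha, hb, h1, h2, h.ne]
  · simp [ifEq, Prog.eval, BinOp.eval, ha, hb, h]
  · have h1 : s.reg a - s.reg b ≠ 0 := by omega
    simp [ifEq, Prog.eval, BinOp.eval, ha, hb, h1, h.ne']

theorem tame_ifEq (a b : ℕ) {p q : Prog} (hp : Tame p) (hq : Tame q) : Tame (ifEq a b p q) :=
  (tame_sub _ _ _).seq ((tame_sub _ _ _).seq (Tame.ite _ hq (Tame.ite _ hq hp)))

/-- Clears the cells that the event in registers `3`, `4`, `5` can touch. -/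
def clearBody : Prog :=
  .seq (.const 8 0) (.seq (.store 1 5 8) (.seq (.load 7 3 5) (.seq (.store 1 7 8)
    (.seq (.store 5 5 8) (.seq (.store 6 5 8) (.seq (mov 7 3) (.seq (inc 7) (.store 4 7 8))))))))

/-- The check that the access in registers `3`, `5` agrees with the label of its
variable; `w` is executed if the label says that the variable is never written. -/
def checkLabel (w : Prog) : Prog :=
  .seq (.load 6 2 5) (.ite 6
    (.seq (dec 6 1) (.seq (.load 7 3 5) (.seq (.ite 6 (.load 7 1 7) (inc 7))
      (.seq (mov 8 3) (.seq (inc 8) (ifEq 7 8 .skip (.const 16 0))))))) w)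

/-- The check that no access contradicts the labels of the variables. -/
def labelBody : Prog :=
  .ite 4 (.seq (dec 4 1) (.ite 4
    (.seq (dec 4 1) (.seq (.ite 4 (.const 8 0) (.seq (mov 8 3) (inc 8))) (.store 1 5 8)))
    (checkLabel (.const 16 0)))) (checkLabel .skip)

/-- Register `7` receives the number of accesses to variable `reg 11` made so far by threads other
than the holder of lock `reg 5`. -/
def foreignCount : Prog :=
  .seq (.load 6 1 5) (.seq (.load 6 4 6) (.op .sub 7 15 6))

/-- Records the access in registers `3`, `5` if it is an access to variable `reg 11`;
`w` is executed if its thread is `reg 12`. -/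
def countAccess (w : Prog) : Prog :=
  ifEq 5 11 (.seq (inc 15) (.seq (mov 8 3) (.seq (inc 8) (.seq (.load 7 4 8) (.seq (inc 7)
    (.seq (.store 4 8 7) (ifEq 3 12 w (.const 14 1)))))))) .skip

/-- The search for the events of a race on variable `reg 11`. -/
def raceBody : Prog :=
  .ite 4 (.seq (dec 4 1) (.ite 4
    (.seq foreignCount (.seq (.load 8 5 5) (.seq
      (ifEq 7 8 .skip (.seq (.const 8 1) (.store 6 5 8)))
      (.seq (dec 4 1) (.seq (.ite 4 (.const 8 0) (.seq (mov 8 3) (inc 8)))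
        (.seq (.store 1 5 8) (.seq foreignCount (.store 5 5 7))))))))
    (countAccess (.const 13 1)))) (countAccess .skip)

/-- The check that no lock protects all accesses to variable `reg 11`. -/
def lockBody : Prog :=
  .ite 4 (.seq (dec 4 1) (.ite 4 (.seq foreignCount (.seq (.load 8 5 5)
    (ifEq 7 8 (.seq (.load 8 6 5) (.ite 8 .skip (.const 16 0))) .skip))) .skip)) .skip

/-- The deterministic part of the verification; the verdict appears in register `16`. -/
def checkRace (A : ℕ) : Prog :=
  .seq (.const 7 0) (.seq (.store 4 7 7) (.seq (forEvents A clearBody) (.ite 10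
    (.seq (.const 13 0) (.seq (.const 14 0) (.seq (.const 15 0) (.seq (forEvents A raceBody)
      (.ite 13 (.ite 14 (.seq (.const 16 1) (forEvents A lockBody)) (.const 16 0))
        (.const 16 0))))))
    (.seq (.const 16 1) (forEvents A labelBody)))))

theorem tame_checkRace (A : ℕ) : Tame (checkRace A) := by
  repeat
    first
    | exact tame_skip
    | exact tame_const _ (by norm_num)
    | exact tame_mov _ _
    | exact tame_sub _ _ _
    | exact tame_inc _
    | exact tame_dec _ (by norm_num)
    | exact tame_load _ _ _
    | exact tame_store _ _ _
    | refine tame_ifEq _ _ ?_ ?_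
    | refine tame_forEvents _ ?_
    | refine Tame.seq ?_ ?_
    | refine Tame.ite _ ?_ ?_

theorem checkRace_writesReg {A r : ℕ} (hr : 17 ≤ r) : ¬ (checkRace A).WritesReg r := by
  have h1 : ¬ clearBody.WritesReg r := by
    simp [clearBody, Prog.WritesReg, mov, inc]; omega
  have h2 : ¬ labelBody.WritesReg r := by
    simp [labelBody, checkLabel, ifEq, Prog.WritesReg, mov, inc, dec]; omega
  have h3 : ¬ raceBody.WritesReg r := by
    simp [raceBody, foreignCount, countAccess, ifEq, Prog.WritesReg, mov, inc, dec]; omega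
  have h4 : ¬ lockBody.WritesReg r := by
    simp [lockBody, foreignCount, ifEq, Prog.WritesReg, dec]; omega
  simp [checkRace, Prog.WritesReg, forEvents_writesReg, h1, h2, h3, h4, (show 10 ≤ r by omega)]
  omega

theorem checkRace_writesArr {A A' : ℕ} (hA : 7 ≤ A') : ¬ (checkRace A).WritesArr A' := by
  have h1 : ¬ clearBody.WritesArr A' := by
    simp [clearBody, Prog.WritesArr, mov, inc]; omega
  have h2 : ¬ labelBody.WritesArr A' := by
    simp [labelBody, checkLabel, ifEq, Prog.WritesArr, mov, inc, dec]; omega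
  have h3 : ¬ raceBody.WritesArr A' := by
    simp [raceBody, foreignCount, countAccess, ifEq, Prog.WritesArr, mov, inc, dec]; omega
  have h4 : ¬ lockBody.WritesArr A' := by
    simp [lockBody, foreignCount, ifEq, Prog.WritesArr, dec]
  simp [checkRace, Prog.WritesArr, forEvents_writesArr, h1, h2, h3, h4]
  omega

theorem checkRace_deterministic (A : ℕ) : (checkRace A).Deterministic := by
  simp [checkRace, forEvents, fetch, clearBody, labelBody, checkLabel, raceBody, foreignCount,
    countAccess, lockBody, ifEq, mov, inc, dec, Prog.Deterministic]

theorem exists_mem_snoc {α : Type*} {es : List α} {e : α} {P : α → Prop} :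
    (∃ f ∈ es ++ [e], P f) ↔ (∃ f ∈ es, P f) ∨ P e := by
  simp [or_and_right, exists_or]

/-- The cells that the events `es` touch are clear. -/
def Cleared (es : List Event) (s : State) : Prop :=
  s.mem 4 0 = 0 ∧ ∀ e ∈ es, s.mem 1 e.arg = 0 ∧ s.mem 1 (s.mem 3 e.arg) = 0 ∧
    s.mem 5 e.arg = 0 ∧ s.mem 6 e.arg = 0 ∧ s.mem 4 (e.thread + 1) = 0

theorem cleared_eval {pre : List Event} {e : Event} {s : State} (h : Cleared pre s)
    (h3 : s.reg 3 = e.thread) (h5 : s.reg 5 = e.arg) :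
    Cleared (pre ++ [e]) (clearBody.eval s) := by
  simp only [Cleared, List.forall_mem_append, List.forall_mem_singleton] at h ⊢
  simp only [clearBody, inc, mov, Prog.eval, BinOp.eval, State.setReg_reg, State.setReg_mem,
    State.setMem_reg, State.setMem_mem, h3, h5]
  simp
  refine ⟨h.1, fun f hf => ?_⟩
  obtain ⟨a1, a2, a3, a4, a5⟩ := h.2 f hf
  simp [a1, a2, a3, a4, a5]

/-- The state of the label check after the events `pre`, in terms of the lock holders of all locks
that the check can ask for. -/
def LabelInv (K V : ℕ → ℕ) (full pre : List Event) (s : State) : Prop :=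
  s.mem 2 = K ∧ s.mem 3 = V ∧ (s.reg 16 ≠ 0 ↔ Explained K V pre) ∧
    ∀ e ∈ full, s.mem 1 e.arg = holder pre e.arg ∧ s.mem 1 (V e.arg) = holder pre (V e.arg)

theorem eval_checkLabel {w : Prog} {s : State} {e : Event} (h3 : s.reg 3 = e.thread)
    (h5 : s.reg 5 = e.arg) (hw : w = .skip ∧ e.opCode = 0 ∨ w = .const 16 0 ∧ e.opCode ≠ 0) :
    ((checkLabel w).eval s).mem = s.mem ∧
      (((checkLabel w).eval s).reg 16 ≠ 0 ↔
        s.reg 16 ≠ 0 ∧ LabelOk (s.mem 2 e.arg) (s.mem 3 e.arg) (s.mem 1) e) := by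
  by_cases hK0 : s.mem 2 e.arg = 0
  · rcases hw with ⟨rfl, h⟩ | ⟨rfl, h⟩ <;>
      simp [checkLabel, Prog.eval, LabelOk, h5, hK0, h]
  · by_cases hK1 : s.mem 2 e.arg = 1
    · simp [checkLabel, Prog.eval, LabelOk, h3, h5, hK1, inc, dec, mov, BinOp.eval, eval_ifEq]
      split_ifs <;> simp_all
    · have hK : s.mem 2 e.arg - 1 ≠ 0 := by omega
      simp [checkLabel, Prog.eval, LabelOk, h3, h5, hK0, hK1, hK, inc, dec, mov, BinOp.eval,
        eval_ifEq]
      split_ifs <;> simp_all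

theorem labelInv_eval {K V : ℕ → ℕ} {full pre post : List Event} {e : Event} {s : State}
    (hfull : full = pre ++ e :: post) (h : LabelInv K V full pre s)
    (h3 : s.reg 3 = e.thread) (h4 : s.reg 4 = e.opCode) (h5 : s.reg 5 = e.arg) :
    LabelInv K V full (pre ++ [e]) (labelBody.eval s) := by
  obtain ⟨hK, hV, h16, hH⟩ := h
  have he := hH e (by simp [hfull])
  have hok : LabelOk (K e.arg) (V e.arg) (s.mem 1) e ↔
      LabelOk (K e.arg) (V e.arg) (holder pre) e := by
    simp only [LabelOk, he.2]
  simp only [LabelInv, holder_snoc, explained_snoc]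
  rcases e with ⟨t, x | x | l | l⟩ <;> simp only [Event.opCode, Event.arg] at h3 h4 h5
  · obtain ⟨h1, h2⟩ := eval_checkLabel (w := .skip) (s := s) (e := ⟨t, .read x⟩) h3 h5
      (.inl ⟨rfl, rfl⟩)
    rw [hK, hV, hok, h16] at h2
    have : labelBody.eval s = (checkLabel .skip).eval s := by
      rw [labelBody, Prog.eval, if_neg (not_not.2 h4)]
    rw [this, h1]
    exact ⟨hK, hV, by rw [h2]; simp [Event.opCode], hH⟩
  · obtain ⟨h1, h2⟩ := eval_checkLabel (w := .const 16 0) (s := (dec 4 1).eval s)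
      (e := ⟨t, .write x⟩) (by simpa [dec, Prog.eval] using h3)
      (by simpa [dec, Prog.eval, Event.arg] using h5)
      (.inr ⟨rfl, by simp [Event.opCode]⟩)
    have hm : ((dec 4 1).eval s).mem = s.mem := rfl
    have hr : ((dec 4 1).eval s).reg 16 = s.reg 16 := by simp [dec, Prog.eval]
    rw [hm, hr, hK, hV, hok, h16] at h2
    have : labelBody.eval s = (checkLabel (.const 16 0)).eval ((dec 4 1).eval s) := by
      simp [labelBody, Prog.eval, h4, dec, BinOp.eval]
    rw [this, h1]
    exact ⟨hK, hV, by rw [h2]; simp [Event.opCode], hH⟩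
  · have hm : (labelBody.eval s).mem = (s.setMem 1 l (t + 1)).mem := by
      funext A i
      simp [labelBody, Prog.eval, h3, h4, h5, dec, inc, mov, BinOp.eval]
    have hr : (labelBody.eval s).reg 16 = s.reg 16 := by
      simp [labelBody, Prog.eval, h4, dec, inc, mov, BinOp.eval]
    rw [hm, hr, h16]
    refine ⟨by funext i; simp [hK], by funext i; simp [hV], by simp [Event.opCode], fun f hf => ?_⟩
    simp [holderStep_acq, Function.update_apply, hH f hf]
  · have hm : (labelBody.eval s).mem = (s.setMem 1 l 0).mem := by
      funext A i
      simp [labelBody, Prog.eval, h4, h5, dec, BinOp.eval]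
    have hr : (labelBody.eval s).reg 16 = s.reg 16 := by
      simp [labelBody, Prog.eval, h4, dec, BinOp.eval]
    rw [hm, hr, h16]
    refine ⟨by funext i; simp [hK], by funext i; simp [hV], by simp [Event.opCode], fun f hf => ?_⟩
    simp [holderStep_rel, Function.update_apply, hH f hf]

/-- The state of the search for a race on variable `x` with a write by thread `g`, after the
events `pre`. Register `15` counts the accesses to `x`, and cell `t + 1` of array `4` those by
thread `t`, so that `reg 15 - mem 4 (holder pre l)` is the number of accesses by threads other than
the holder of `l` (by all threads if `l` is free). Cell `l` of array `5` is the value that this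
number had just after the last event on `l`; the number has grown since iff an unprotected access
happened since. Cell `l` of array `6` records whether an unprotected access happened before. -/
def RaceInv (x g : ℕ) (full pre : List Event) (s : State) : Prop :=
  s.reg 11 = x ∧ s.reg 12 = g ∧
    (s.reg 13 ≠ 0 ↔ ∃ e ∈ pre, e.op = .write x ∧ e.thread = g) ∧
    (s.reg 14 ≠ 0 ↔ ∃ e ∈ pre, e.Accesses x ∧ e.thread ≠ g) ∧
    s.mem 4 0 = 0 ∧ (∀ e ∈ full, s.mem 4 (e.thread + 1) ≤ s.reg 15) ∧
    ∀ e ∈ full, s.mem 1 e.arg = holder pre e.arg ∧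
      s.mem 5 e.arg ≤ s.reg 15 - s.mem 4 (holder pre e.arg) ∧
      (s.mem 6 e.arg ≠ 0 ∨ s.mem 5 e.arg ≠ s.reg 15 - s.mem 4 (holder pre e.arg) ↔
        Unprotected pre x e.arg)

theorem raceInv_nil {full : List Event} {s : State} (h : Cleared full s) (h13 : s.reg 13 = 0)
    (h14 : s.reg 14 = 0) (h15 : s.reg 15 = 0) :
    RaceInv (s.reg 11) (s.reg 12) full [] s := by
  refine ⟨rfl, rfl, by simp [h13], by simp [h14], h.1, fun e he => ?_, fun e he => ?_⟩
  · rw [(h.2 e he).2.2.2.2]; omega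
  · obtain ⟨a1, a2, a3, a4, a5⟩ := h.2 e he
    simp [a1, a3, a4, h15, h.1, unprotected_nil]

/-- An access event. The counter difference of a lock grows iff the thread of the event does not
hold the lock. -/
theorem raceInv_eval_acc {x g : ℕ} {full pre post : List Event} {e : Event} {s : State} {w : Prog}
    (hfull : full = pre ++ e :: post) (h : RaceInv x g full pre s)
    (h3 : s.reg 3 = e.thread) (h4 : e.opCode ≤ 1) (h5 : s.reg 5 = e.arg)
    (hw : w = .skip ∧ e.opCode = 0 ∨ w = .const 13 1 ∧ e.opCode = 1) :
    RaceInv x g full (pre ++ [e]) ((countAccess w).eval s) := by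
  obtain ⟨h11, h12, h13, h14, h40, hle, hH⟩ := h
  have hstep : holderStep (holder pre) e = holder pre := by
    rcases e with ⟨t, y | y | y | y⟩ <;> simp_all [Event.opCode, holderStep]
  by_cases hx : e.arg = x
  · have hacc : e.Accesses x := hx ▸ Event.accesses_of_opCode_le h4
    have hmem1 : ((countAccess w).eval s).mem 1 = s.mem 1 := by
      funext i
      rcases hw with ⟨rfl, -⟩ | ⟨rfl, -⟩ <;>
      simp [countAccess, eval_ifEq, Prog.eval, h3, h5, h11, h12, hx, inc, mov, BinOp.eval] <;>
      split_ifs <;> simp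
    have hmem5 : ((countAccess w).eval s).mem 5 = s.mem 5 := by
      funext i
      rcases hw with ⟨rfl, -⟩ | ⟨rfl, -⟩ <;>
      simp [countAccess, eval_ifEq, Prog.eval, h3, h5, h11, h12, hx, inc, mov, BinOp.eval] <;>
      split_ifs <;> simp
    have hmem6 : ((countAccess w).eval s).mem 6 = s.mem 6 := by
      funext i
      rcases hw with ⟨rfl, -⟩ | ⟨rfl, -⟩ <;>
      simp [countAccess, eval_ifEq, Prog.eval, h3, h5, h11, h12, hx, inc, mov, BinOp.eval] <;>
      split_ifs <;> simp
    have hmem4 : ∀ i, ((countAccess w).eval s).mem 4 i =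
        if i = e.thread + 1 then s.mem 4 (e.thread + 1) + 1 else s.mem 4 i := by
      intro i
      rcases hw with ⟨rfl, -⟩ | ⟨rfl, -⟩ <;>
      simp [countAccess, eval_ifEq, Prog.eval, h3, h5, h11, h12, hx, inc, mov, BinOp.eval] <;>
      split_ifs <;> simp_all
    have hreg15 : ((countAccess w).eval s).reg 15 = s.reg 15 + 1 := by
      rcases hw with ⟨rfl, -⟩ | ⟨rfl, -⟩ <;>
      simp [countAccess, eval_ifEq, Prog.eval, h3, h5, h11, h12, hx, inc, mov, BinOp.eval] <;>
      split_ifs <;> simp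
    refine ⟨?_, ?_, ?_, ?_, ?_, ?_, ?_⟩
    · rcases hw with ⟨rfl, -⟩ | ⟨rfl, -⟩ <;>
      simp [countAccess, eval_ifEq, Prog.eval, h3, h5, h11, h12, hx, inc, mov, BinOp.eval] <;>
      split_ifs <;> simp [h11]
    · rcases hw with ⟨rfl, -⟩ | ⟨rfl, -⟩ <;>
      simp [countAccess, eval_ifEq, Prog.eval, h3, h5, h11, h12, hx, inc, mov, BinOp.eval] <;>
      split_ifs <;> simp [h12]
    · simp only [exists_mem_snoc, ← h13]
      rcases hw with ⟨rfl, h⟩ | ⟨rfl, h⟩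
      · have : e.op ≠ .write x := by
          intro hop; simp [Event.opCode, hop] at h
        simp [countAccess, eval_ifEq, Prog.eval, h3, h5, h11, h12, hx, inc, mov, BinOp.eval, this]
        split_ifs <;> simp
      · have : e.op = .write x := by
          rcases hacc with hop | hop
          · simp [Event.opCode, hop] at h
          · exact hop
        simp [countAccess, eval_ifEq, Prog.eval, h3, h5, h11, h12, hx, inc, mov, BinOp.eval, this]
        split_ifs with hg <;> simp [hg]
    · simp only [exists_mem_snoc, ← h14]
      rcases hw with ⟨rfl, h⟩ | ⟨rfl, h⟩ <;>
      simp [countAccess, eval_ifEq, Prog.eval, h3, h5, h11, h12, hx, inc, mov, BinOp.eval, hacc] <;>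
      split_ifs with hg <;> simp [hg]
    · simp [hmem4, h40]
    · intro f hf
      have := hle f hf
      have := hle e (by simp [hfull])
      rw [hmem4, hreg15]
      split_ifs <;> omega
    · intro f hf
      obtain ⟨hf1, hf2, hf3⟩ := hH f hf
      rw [holder_snoc, hstep, unprotected_snoc, hmem1, hmem5, hmem6, hmem4, hreg15, ← hf3]
      have hfle : s.mem 4 (holder pre f.arg) ≤ s.reg 15 := by
        rcases holder_eq_zero_or pre f.arg with h0 | ⟨-, d, hd, h0⟩
        · rw [h0, h40]; omega
        · rw [h0]; exact hle d (by simp [hfull, hd])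
      refine ⟨hf1, ?_, ?_⟩
      · split_ifs with hh
        · rw [hh] at hf2 hfle; omega
        · omega
      · split_ifs with hh
        · rw [hh] at hf2 hfle ⊢
          simp only [ne_eq, not_true_eq_false, and_false, or_false]
          rw [show s.reg 15 + 1 - (s.mem 4 (e.thread + 1) + 1) =
            s.reg 15 - s.mem 4 (e.thread + 1) by omega]
        · simp only [hacc, ne_eq, hh, not_false_eq_true, and_self, or_true, iff_true]
          right; omega
  · have hacc : ¬ e.Accesses x := fun h => hx h.arg_eq
    have hop : e.op ≠ .write x := fun h => hacc (.inr h)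
    have : (countAccess w).eval s =
        (s.setReg 6 (e.arg - x)).setReg 7 (x - e.arg) := by
      simp [countAccess, eval_ifEq, Prog.eval, h5, h11, hx]
    rw [this]
    refine ⟨by simp [h11], by simp [h12], ?_, ?_, h40, by simpa using hle, fun f hf => ?_⟩
    · simp only [exists_mem_snoc, ← h13]
      simp [hop]
    · simp only [exists_mem_snoc, ← h14]
      simp [hacc]
    · rw [holder_snoc, hstep, unprotected_snoc]
      simpa [hacc] using hH f hf

/-- An event on the lock `l`, after which `l` is held according to `h'`. -/
theorem raceInv_eval_lock {x g l : ℕ} {full pre : List Event} {e : Event} {s s' : State}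
    (h : RaceInv x g full pre s) (hop : 2 ≤ e.opCode) {h' : ℕ}
    (hstep : holderStep (holder pre) e = Function.update (holder pre) l h')
    (hr : ∀ r, 10 ≤ r → s'.reg r = s.reg r)
    (hm1 : ∀ i, s'.mem 1 i = if i = l then h' else s.mem 1 i)
    (hm4 : ∀ i, s'.mem 4 i = s.mem 4 i)
    (hm5 : ∀ i, s'.mem 5 i = if i = l then s.reg 15 - s.mem 4 h' else s.mem 5 i)
    (hm6 : ∀ i, s'.mem 6 i = if i = l ∧ s.reg 15 - s.mem 4 (s.mem 1 l) ≠ s.mem 5 l then 1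
      else s.mem 6 i) :
    RaceInv x g full (pre ++ [e]) s' := by
  obtain ⟨h11, h12, h13, h14, h40, hle, hH⟩ := h
  have hacc : ∀ y, ¬ e.Accesses y := fun y h => by have := h.opCode_le; omega
  have hop : ∀ y, e.op ≠ .write y := fun y h => hacc y (.inr h)
  refine ⟨by simp [hr, h11], by simp [hr, h12], ?_, ?_, by rw [hm4, h40], ?_, fun f hf => ?_⟩
  · simp only [exists_mem_snoc, ← h13]
    simp [hop, hr]
  · simp only [exists_mem_snoc, ← h14]
    simp [hacc, hr]
  · intro f hf
    rw [hm4, hr 15 (by omega)]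
    exact hle f hf
  · obtain ⟨hf1, hf2, hf3⟩ := hH f hf
    rw [holder_snoc, hstep, unprotected_snoc, Function.update_apply, hm1, hm5, hm6, hm4,
      hr 15 (by omega), ← hf3]
    by_cases hfl : f.arg = l
    · rw [hfl] at hf1
      simp only [hfl, hacc, if_true, true_and, false_and, or_false, le_refl, ne_eq,
        not_true_eq_false, hf1]
      split_ifs with hne
      · simp [hne]
      · simp [Ne.symm hne]
    · simp [hfl, hacc, hf1, hf2]

theorem raceInv_eval {x g : ℕ} {full pre post : List Event} {e : Event} {s : State}
    (hfull : full = pre ++ e :: post) (h : RaceInv x g full pre s)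
    (h3 : s.reg 3 = e.thread) (h4 : s.reg 4 = e.opCode) (h5 : s.reg 5 = e.arg) :
    RaceInv x g full (pre ++ [e]) (raceBody.eval s) := by
  rcases e with ⟨t, y | y | l | l⟩ <;> simp only [Event.opCode, Event.arg] at h3 h4 h5
  · have : raceBody.eval s = (countAccess .skip).eval s := by
      rw [raceBody, Prog.eval, if_neg (not_not.2 h4)]
    rw [this]
    exact raceInv_eval_acc hfull h h3 (by simp [Event.opCode]) h5 (.inl ⟨rfl, rfl⟩)
  · have : raceBody.eval s = (countAccess (.const 13 1)).eval ((dec 4 1).eval s) := by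
      simp [raceBody, Prog.eval, h4, dec, BinOp.eval]
    rw [this]
    refine raceInv_eval_acc hfull ?_ (by simpa [dec, Prog.eval] using h3) (by simp [Event.opCode])
      (by simpa [dec, Prog.eval, Event.arg] using h5) (.inr ⟨rfl, rfl⟩)
    simpa [RaceInv, dec, Prog.eval] using h
  · by_cases hne : s.reg 15 - s.mem 4 (s.mem 1 l) = s.mem 5 l
    all_goals
      refine raceInv_eval_lock h (l := l) (h' := t + 1) (by simp [Event.opCode])
        (holderStep_acq _ _ _) ?_ ?_ ?_ ?_ ?_
      all_goals
        intros
        simp [raceBody, foreignCount, eval_ifEq, Prog.eval, h3, h4, h5, dec, inc, mov, BinOp.eval,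
          hne]
        try grind
  · by_cases hne : s.reg 15 - s.mem 4 (s.mem 1 l) = s.mem 5 l
    all_goals
      refine raceInv_eval_lock h (l := l) (h' := 0) (by simp [Event.opCode])
        (holderStep_rel _ _ _) ?_ ?_ ?_ ?_ ?_
      all_goals
        intros
        simp [raceBody, foreignCount, eval_ifEq, Prog.eval, h4, h5, dec, inc, mov, BinOp.eval, hne]
        try grind

theorem RaceInv.unprotected_iff {x g : ℕ} {full : List Event} {s : State}
    (h : RaceInv x g full full s) {e : Event} (he : e ∈ full) :
    s.mem 6 e.arg ≠ 0 ∨ s.mem 5 e.arg ≠ s.reg 15 - s.mem 4 (s.mem 1 e.arg) ↔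
      Unprotected full x e.arg := by
  obtain ⟨h1, -, h2⟩ := h.2.2.2.2.2.2 e he
  rw [h1, h2]

theorem lockBody_eval {x g : ℕ} {full pre post : List Event} {e : Event} {s : State}
    (hfull : full = pre ++ e :: post) (h : RaceInv x g full full s)
    (h16 : s.reg 16 ≠ 0 ↔ ∀ e ∈ pre, 2 ≤ e.opCode → Unprotected full x e.arg)
    (h4 : s.reg 4 = e.opCode) (h5 : s.reg 5 = e.arg) :
    RaceInv x g full full (lockBody.eval s) ∧ ((lockBody.eval s).reg 16 ≠ 0 ↔
      ∀ f ∈ pre ++ [e], 2 ≤ f.opCode → Unprotected full x f.arg) := by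
  have hu := h.unprotected_iff (e := e) (by simp [hfull])
  have hst : lockBody.Straight := by
    simp [lockBody, foreignCount, ifEq, dec, Prog.Straight]
  have hr := hst.reaches s
  have hm : (lockBody.eval s).mem = s.mem := by
    funext A
    exact hr.mem_eq (by simp [lockBody, foreignCount, ifEq, Prog.WritesArr, dec])
  have hreg : ∀ r ∈ [11, 12, 13, 14, 15], (lockBody.eval s).reg r = s.reg r := by
    intro r hr'
    refine hr.reg_eq ?_
    fin_cases hr' <;> simp [lockBody, foreignCount, ifEq, Prog.WritesReg, dec]
  refine ⟨?_, ?_⟩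
  · simp only [RaceInv, hm, hreg, List.mem_cons, List.not_mem_nil, true_or, or_true]
    exact h
  · rw [List.forall_mem_append, List.forall_mem_singleton, ← h16, ← hu, ← h5,
      ne_comm (a := s.mem 5 (s.reg 5))]
    by_cases h0 : s.reg 4 = 0
    · simp [lockBody, Prog.eval, h0, show ¬ 2 ≤ e.opCode by omega]
    · by_cases h1 : s.reg 4 = 1
      · simp [lockBody, Prog.eval, h1, show ¬ 2 ≤ e.opCode by omega, dec, BinOp.eval]
      · have h2 : s.reg 4 - 1 ≠ 0 := by omega
        by_cases hne : s.reg 15 - s.mem 4 (s.mem 1 (s.reg 5)) = s.mem 5 (s.reg 5) <;>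
        by_cases hg : s.mem 6 (s.reg 5) = 0 <;>
          simp [lockBody, Prog.eval, h0, h2, foreignCount, eval_ifEq, dec, BinOp.eval, hne, hg,
            show 2 ≤ e.opCode by omega]

/-- Thread `g` writes `x`, another thread accesses `x`, and no lock protects all accesses to `x`. -/
def RaceWitness (x g : ℕ) (es : List Event) : Prop :=
  (∃ e ∈ es, e.op = .write x ∧ e.thread = g) ∧ (∃ e ∈ es, e.Accesses x ∧ e.thread ≠ g) ∧
    ∀ e ∈ es, 2 ≤ e.opCode → Unprotected es x e.arg

theorem Trace.hasLockSetRace_iff (σ : Trace) :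
    σ.HasLockSetRace ↔ ∃ x g, RaceWitness x g σ.events := by
  refine exists_congr fun x => ?_
  rw [σ.hasLockSetRaceOn_iff]
  constructor
  · rintro ⟨⟨e, he, f, hf, hew, hfa, hne⟩, h⟩
    exact ⟨e.thread, ⟨e, he, hew, rfl⟩, ⟨f, hf, hfa, hne⟩, fun e _ _ => h _⟩
  · rintro ⟨g, ⟨e, he, hew, rfl⟩, ⟨f, hf, hfa, hne⟩, h⟩
    refine ⟨⟨e, he, f, hf, hew, hfa, hne⟩, fun l => ?_⟩
    -- a lock without events protects nothing
    by_contra hl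
    obtain ⟨pre, post, heq⟩ := List.append_of_mem he
    have h1 := not_unprotected_iff.1 hl pre e post heq (.inr hew)
    have key : ∀ es : List Event, holder es l ≠ 0 → ∃ d ∈ es, 2 ≤ d.opCode ∧ d.arg = l := by
      intro es
      induction es using List.reverseRecOn with
      | nil => simp
      | append_singleton es d ih =>
        rw [holder_snoc, exists_mem_snoc]
        rcases d with ⟨t, y | y | l' | l'⟩
        · exact fun h => .inl (ih h)
        · exact fun h => .inl (ih h)
        · rw [holderStep_acq, Function.update_apply]
          split_ifs with hll
          · exact fun _ => .inr ⟨by simp [Event.opCode], hll.symm⟩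
          · exact fun h => .inl (ih h)
        · rw [holderStep_rel, Function.update_apply]
          split_ifs with hll
          · exact fun h => absurd rfl h
          · exact fun h => .inl (ih h)
    obtain ⟨d, hd, hd2, hdl⟩ := key pre (by omega)
    exact hl (hdl ▸ h d (by simp [heq, hd]) hd2)

/-- The claim of the verifier in state `s` about a trace with events `es`. -/
def Claim (es : List Event) (s : State) : Prop :=
  if s.reg 10 ≠ 0 then RaceWitness (s.reg 11) (s.reg 12) es else Explained (s.mem 2) (s.mem 3) es

/-- A bound on the number of steps of the verification for each event. -/
def checkCost : ℕ :=
  clearBody.cost + raceBody.cost + labelBody.cost + lockBody.cost + 100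

theorem reaches_checkRace {A : ℕ} (hA : 7 ≤ A) {es : List Event} {s : State}
    (hblock : s.block A (s.reg 17) (s.reg 18) = eventsCode es) :
    ∃ s', Reaches (checkRace A) s (checkCost * (es.length + 1)) s' ∧
      (s'.reg 16 ≠ 0 ↔ Claim es s) := by
  have frame : ∀ {p : Prog} {c : ℕ} {s s' : State}, Reaches p s c s' → ¬ p.WritesReg 17 →
      ¬ p.WritesReg 18 → ¬ p.WritesArr A →
      s.block A (s.reg 17) (s.reg 18) = eventsCode es →
      s'.block A (s'.reg 17) (s'.reg 18) = eventsCode es := by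
    intro p c s s' h h1 h2 h3 hb
    rw [h.reg_eq h1, h.reg_eq h2, ← hb]
    simp only [State.block, h.mem_eq h3]
  have hc : clearBody.Straight := by simp [clearBody, mov, inc, Prog.Straight]
  have hra : raceBody.Straight := by
    simp [raceBody, foreignCount, countAccess, ifEq, mov, inc, dec, Prog.Straight]
  have hlo : lockBody.Straight := by
    simp [lockBody, foreignCount, ifEq, dec, Prog.Straight]
  have hla : labelBody.Straight := by
    simp [labelBody, checkLabel, ifEq, mov, inc, dec, Prog.Straight]
  -- clearing the arrays
  have hp1 : (Prog.seq (.const 7 0) (.store 4 7 7)).Straight := ⟨trivial, trivial⟩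
  set s₁ := (Prog.seq (.const 7 0) (.store 4 7 7)).eval s with hs₁
  have r1 := hp1.reaches s
  have hb₁ := frame r1 (by simp [Prog.WritesReg]) (by simp [Prog.WritesReg])
    (by simp [Prog.WritesArr]; omega) hblock
  obtain ⟨s₂, r2, hI₂⟩ := reaches_forEvents (A := A) hc
    (by simp [clearBody, Prog.WritesReg, mov, inc])
    (by simp [clearBody, Prog.WritesReg, mov, inc])
    (by simp [clearBody, Prog.WritesArr, mov, inc]; omega)
    (I := Cleared) (fun es s s' _ hm h => by simpa only [Cleared, hm] using h) es
    (fun pre e post s _ hI h3 h4 h5 => cleared_eval hI h3 h5) s₁ hb₁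
    ⟨by simp [hs₁, Prog.eval], by simp⟩
  have fr : ∀ r ∈ [10, 11, 12], s₂.reg r = s.reg r := by
    intro r hr
    rw [r2.reg_eq, r1.reg_eq]
    · fin_cases hr <;> simp [Prog.WritesReg]
    · fin_cases hr <;> exact forEvents_writesReg (by simp [clearBody, Prog.WritesReg, mov, inc])
        (by norm_num)
  have fm : ∀ B ∈ [2, 3], s₂.mem B = s.mem B := by
    intro B hB
    rw [r2.mem_eq, r1.mem_eq]
    · fin_cases hB <;> simp [Prog.WritesArr]
    · fin_cases hB <;> exact forEvents_writesArr (by simp [clearBody, Prog.WritesArr, mov, inc])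
  have hb₂ := frame r2 (forEvents_writesReg (by simp [clearBody, Prog.WritesReg, mov, inc])
      (by norm_num)) (forEvents_writesReg (by simp [clearBody, Prog.WritesReg, mov, inc])
      (by norm_num))
      (forEvents_writesArr (by simp [clearBody, Prog.WritesArr, mov, inc]; omega)) hb₁
  have h10 := fr 10 (by simp)
  have h11 := fr 11 (by simp)
  have h12 := fr 12 (by simp)
  have hpre : ∀ {q : Prog} {c : ℕ} {s' : State}, Reaches q s₂ c s' →
      Reaches (.seq (.const 7 0) (.seq (.store 4 7 7) (.seq (forEvents A clearBody) q))) s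
        (2 + ((clearBody.cost + 12) * es.length + 3) + c) s' := by
    intro q c s' hq
    have ra : Reaches (.const 7 0) s 1 (s.setReg 7 0) :=
      Prog.Straight.reaches (p := .const 7 0) trivial s
    have rb : Reaches (.store 4 7 7) (s.setReg 7 0) 1 s₁ :=
      Prog.Straight.reaches (p := .store 4 7 7) trivial _
    exact (ra.seq (rb.seq (r2.seq hq))).mono (by omega)
  by_cases hs10 : s.reg 10 = 0
  · -- verification of the labels
    have hp3 : (Prog.const 16 1).Straight := trivial
    have r3 := hp3.reaches s₂
    have hb₃ := frame r3 (by simp [Prog.WritesReg]) (by simp [Prog.WritesReg])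
      (by simp [Prog.WritesArr]) hb₂
    obtain ⟨s₄, r4, hI₄⟩ := reaches_forEvents (A := A) hla
      (by simp [labelBody, checkLabel, ifEq, Prog.WritesReg, mov, inc, dec])
      (by simp [labelBody, checkLabel, ifEq, Prog.WritesReg, mov, inc, dec])
      (by simp [labelBody, checkLabel, ifEq, Prog.WritesArr, mov, inc, dec]; omega)
      (I := LabelInv (s.mem 2) (s.mem 3) es)
      (fun es s s' hr hm h => by simpa only [LabelInv, hm, hr 16 (by norm_num)] using h) es
      (fun pre e post s hf hI h3 h4 h5 => labelInv_eval hf hI h3 h4 h5) _ hb₃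
      ⟨by simp [Prog.eval, fm], by simp [Prog.eval, fm], by simp [Prog.eval, explained_nil], by
        intro e he
        obtain ⟨a1, a2, -⟩ := hI₂.2 e he
        rw [fm 3 (by simp)] at a2
        simp [Prog.eval, a1, a2]⟩
    refine ⟨s₄, ?_, ?_⟩
    · refine (hpre (Reaches.ite_false (by rw [h10, hs10]) (r3.seq r4))).mono ?_
      simp only [checkCost, Prog.cost]
      ring_nf
      nlinarith
    · rw [Claim, if_neg (not_not.2 hs10)]
      exact hI₄.2.2.1
  · -- verification of a race
    have hp3 : (Prog.seq (.const 13 0) (.seq (.const 14 0) (.const 15 0))).Straight :=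
      ⟨trivial, trivial, trivial⟩
    have r3 := hp3.reaches s₂
    set s₃ := (Prog.seq (.const 13 0) (.seq (.const 14 0) (.const 15 0))).eval s₂ with hs₃
    have hm₃ : s₃.mem = s₂.mem := rfl
    have hb₃ := frame r3 (by simp [Prog.WritesReg]) (by simp [Prog.WritesReg])
      (by simp [Prog.WritesArr]) hb₂
    have hI₃ : RaceInv (s₃.reg 11) (s₃.reg 12) es [] s₃ :=
      raceInv_nil (by simpa only [Cleared, hm₃] using hI₂) (by simp [hs₃, Prog.eval])
        (by simp [hs₃, Prog.eval]) (by simp [hs₃, Prog.eval])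
    have e11 : s₃.reg 11 = s.reg 11 := by simp [hs₃, Prog.eval, h11]
    have e12 : s₃.reg 12 = s.reg 12 := by simp [hs₃, Prog.eval, h12]
    rw [e11, e12] at hI₃
    have wr : ∀ r ∈ [1, 2, 17, 18], ¬ raceBody.WritesReg r := by
      intro r hr
      fin_cases hr <;>
        simp [raceBody, foreignCount, countAccess, ifEq, Prog.WritesReg, mov, inc, dec]
    have wa : ¬ raceBody.WritesArr A := by
      simp [raceBody, foreignCount, countAccess, ifEq, Prog.WritesArr, mov, inc, dec]; omega
    obtain ⟨s₄, r4, hI₄⟩ := reaches_forEvents (A := A) hra (wr 1 (by simp)) (wr 2 (by simp)) wa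
      (I := RaceInv (s.reg 11) (s.reg 12) es)
      (fun es s s' hr hm h => by
        simpa only [RaceInv, hm, hr 11 (by norm_num), hr 12 (by norm_num), hr 13 (by norm_num),
          hr 14 (by norm_num), hr 15 (by norm_num)] using h) es
      (fun pre e post s hf hI h3 h4 h5 => raceInv_eval hf hI h3 h4 h5) _ hb₃ hI₃
    have hb₄ := frame r4 (forEvents_writesReg (wr 17 (by simp)) (by norm_num))
      (forEvents_writesReg (wr 18 (by simp)) (by norm_num)) (forEvents_writesArr wa) hb₃
    have hlast : ∃ s', Reaches (.ite 13 (.ite 14 (.seq (.const 16 1) (forEvents A lockBody))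
        (.const 16 0)) (.const 16 0)) s₄ ((lockBody.cost + 12) * es.length + 3 + 3) s' ∧
        (s'.reg 16 ≠ 0 ↔ RaceWitness (s.reg 11) (s.reg 12) es) := by
      have h13 := hI₄.2.2.1
      have h14 := hI₄.2.2.2.1
      have rz : Reaches (.const 16 0) s₄ 1 (s₄.setReg 16 0) :=
        Prog.Straight.reaches (p := .const 16 0) trivial _
      by_cases c13 : s₄.reg 13 = 0
      · refine ⟨_, (rz.ite_false c13).mono (by omega), ?_⟩
        rw [RaceWitness, ← h13, c13]
        simp
      by_cases c14 : s₄.reg 14 = 0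
      · refine ⟨_, ((rz.ite_false c14).ite_true c13).mono (by omega), ?_⟩
        rw [RaceWitness, ← h14, c14]
        simp
      have ro : Reaches (.const 16 1) s₄ 1 (s₄.setReg 16 1) :=
        Prog.Straight.reaches (p := .const 16 1) trivial _
      have hb₅ := frame ro (by simp [Prog.WritesReg]) (by simp [Prog.WritesReg])
        (by simp [Prog.WritesArr]) hb₄
      obtain ⟨s₆, r6, hI₆⟩ := reaches_forEvents (A := A) hlo
        (by simp [lockBody, foreignCount, ifEq, Prog.WritesReg, dec])
        (by simp [lockBody, foreignCount, ifEq, Prog.WritesReg, dec])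
        (by simp [lockBody, foreignCount, ifEq, Prog.WritesArr, dec])
        (I := fun pre s' => RaceInv (s.reg 11) (s.reg 12) es es s' ∧
          (s'.reg 16 ≠ 0 ↔ ∀ e ∈ pre, 2 ≤ e.opCode → Unprotected es (s.reg 11) e.arg))
        (fun es s s' hr hm h => by
          simpa only [RaceInv, hm, hr 11 (by norm_num), hr 12 (by norm_num), hr 13 (by norm_num),
            hr 14 (by norm_num), hr 15 (by norm_num), hr 16 (by norm_num)] using h) es
        (fun pre e post s hf hI h3 h4 h5 => lockBody_eval hf hI.1 hI.2 h4 h5) _ hb₅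
        ⟨by simpa [RaceInv] using hI₄, by simp⟩
      refine ⟨s₆, (((ro.seq r6).ite_true c14).ite_true c13).mono (by omega), ?_⟩
      rw [hI₆.2, RaceWitness, ← h13, ← h14]
      simp [c13, c14]
    obtain ⟨s₅, r5, h5⟩ := hlast
    refine ⟨s₅, ?_, by rw [h5, Claim, if_pos hs10]⟩
    have ra : Reaches (.const 13 0) s₂ 1 (s₂.setReg 13 0) :=
      Prog.Straight.reaches (p := .const 13 0) trivial _
    have rb : Reaches (.const 14 0) (s₂.setReg 13 0) 1 ((s₂.setReg 13 0).setReg 14 0) :=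
      Prog.Straight.reaches (p := .const 14 0) trivial _
    have rc : Reaches (.const 15 0) ((s₂.setReg 13 0).setReg 14 0) 1 s₃ :=
      Prog.Straight.reaches (p := .const 15 0) trivial _
    refine (hpre (Reaches.ite_true (by rw [h10]; exact hs10)
      (ra.seq (rb.seq (rc.seq (r4.seq r5)))))).mono ?_
    simp only [checkCost]
    ring_nf
    nlinarith

/-! ### Guessing and verifying the answer to a query -/

/-- Guesses labels of finitely many variables. -/
def guessLabels : Prog :=
  .seq (.guess 7) (.loop 7 (.seq (.guess 8) (.seq (.guess 6) (.seq (.store 2 8 6)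
    (.seq (.guess 6) (.seq (.store 3 8 6) (.guess 7)))))))

/-- Guesses the answer, the variable and the thread in the registers `10`, `11`, `12`, and the
labels in the arrays `2`, `3`. -/
def guessClaim : Prog :=
  .seq (.guess 10) (.seq (.guess 11) (.seq (.guess 12) guessLabels))

/-- Register `7` tells whether the loop guesses another label. -/
theorem exec_loop_guessLabels {B : ℕ} {K V : ℕ → ℕ} (hB : 1 ≤ B) (xs : List ℕ)
    (hxs : ∀ x ∈ xs, x ≤ B ∧ K x ≤ B ∧ V x ≤ B) :
    ∀ s : State, s.Bounded B → (s.reg 7 ≠ 0 ↔ xs ≠ []) →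
      ∃ s', Exec noOracle B (.loop 7 (.seq (.guess 8) (.seq (.guess 6) (.seq (.store 2 8 6)
          (.seq (.guess 6) (.seq (.store 3 8 6) (.guess 7))))))) s (7 * xs.length + 1) [] s' ∧
        s'.Bounded B ∧ (∀ x ∈ xs, s'.mem 2 x = K x ∧ s'.mem 3 x = V x) ∧
        ∀ x, (s'.mem 2 x = s.mem 2 x ∨ s'.mem 2 x = K x) ∧
          (s'.mem 3 x = s.mem 3 x ∨ s'.mem 3 x = V x) := by
  induction xs with
  | nil =>
    intro s hs h7
    exact ⟨s, .loop_done (by simpa using h7), hs, by simp, fun x => ⟨.inl rfl, .inl rfl⟩⟩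
  | cons x xs ih =>
    intro s hs h7
    obtain ⟨hx, hK, hV⟩ := hxs x (by simp)
    have hv : (if xs = [] then 0 else 1) ≤ B := by split_ifs <;> omega
    set s₁ := (((((s.setReg 8 x).setReg 6 (K x)).setMem 2 x (K x)).setReg 6 (V x)).setMem 3 x
      (V x)).setReg 7 (if xs = [] then 0 else 1) with hs₁
    have hb₁ : s₁.Bounded B :=
      (((((hs.setReg 8 hx).setReg 6 hK).setMem 2 x hK).setReg 6 hV).setMem 3 x hV).setReg 7 hv
    obtain ⟨s', h1, h2, h3, h4⟩ := ih (fun y hy => hxs y (by simp [hy])) s₁ hb₁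
      (by by_cases h : xs = [] <;> simp [hs₁, h])
    have e : Exec noOracle B (.seq (.guess 8) (.seq (.guess 6) (.seq (.store 2 8 6)
        (.seq (.guess 6) (.seq (.store 3 8 6) (.guess 7)))))) s (1 + (1 + (1 + (1 + (1 + 1))))) []
        s₁ := by
      refine .seq (Q := []) (.guess _ 8 x hx) (.seq (Q := []) (.guess _ 6 (K x) hK)
        (.seq (Q := []) (.store _ 2 8 6 (by simpa using hK))
        (.seq (Q := []) (.guess _ 6 (V x) hV)
        (.seq (Q := []) (.store _ 3 8 6 (by simpa using hV)) ?_))))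
      simpa [hs₁] using Exec.guess (O := noOracle) (W := B) (((((s.setReg 8 x).setReg 6
        (K x)).setMem 2 x (K x)).setReg 6 (V x)).setMem 3 x (V x)) 7 _ hv
    refine ⟨s', ?_, h2, ?_, ?_⟩
    · rw [List.length_cons, show 7 * (xs.length + 1) + 1 =
        1 + (1 + (1 + (1 + (1 + 1)))) + (7 * xs.length + 1) + 1 by ring]
      exact .loop_again (Q := []) (h7.2 (by simp)) e h1
    · intro y hy
      obtain ⟨a1, a2⟩ := h4 y
      rcases List.mem_cons.1 hy with rfl | hy
      · exact ⟨by rcases a1 with a | a <;> simp [a, hs₁], by rcases a2 with a | a <;> simp [a, hs₁]⟩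
      · exact h3 y hy
    · intro y
      obtain ⟨a1, a2⟩ := h4 y
      by_cases hyx : y = x
      · subst hyx
        exact ⟨.inr (by rcases a1 with a | a <;> simp [a, hs₁]),
          .inr (by rcases a2 with a | a <;> simp [a, hs₁])⟩
      · simpa [hs₁, hyx] using h4 y

theorem exec_guessClaim {B b x g : ℕ} {K V : ℕ → ℕ} (hB : 1 ≤ B) (hb : b ≤ B) (hx : x ≤ B)
    (hg : g ≤ B) (xs : List ℕ) (hxs : ∀ x ∈ xs, x ≤ B ∧ K x ≤ B ∧ V x ≤ B) {s : State}
    (hs : s.Bounded B) :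
    ∃ s', Exec noOracle B guessClaim s (7 * xs.length + 5) [] s' ∧ s'.Bounded B ∧
      s'.reg 10 = b ∧ s'.reg 11 = x ∧ s'.reg 12 = g ∧
      ∀ x ∈ xs, s'.mem 2 x = K x ∧ s'.mem 3 x = V x := by
  have hv : (if xs = [] then 0 else 1) ≤ B := by split_ifs <;> omega
  obtain ⟨s', h1, h2, h3, -⟩ := exec_loop_guessLabels hB xs hxs
    ((((s.setReg 10 b).setReg 11 x).setReg 12 g).setReg 7 (if xs = [] then 0 else 1))
    ((((hs.setReg 10 hb).setReg 11 hx).setReg 12 hg).setReg 7 hv)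
    (by by_cases h : xs = [] <;> simp [h])
  refine ⟨s', ?_, h2, ?_, ?_, ?_, h3⟩
  · rw [show 7 * xs.length + 5 = 1 + (1 + (1 + (1 + (7 * xs.length + 1)))) by ring]
    exact .seq (Q := []) (.guess s 10 b hb) (.seq (Q := []) (.guess _ 11 x hx)
      (.seq (Q := []) (.guess _ 12 g hg) (.seq (Q := []) (.guess _ 7 _ hv) h1)))
  all_goals rw [h1.reg_eq (by simp [Prog.WritesReg])]; simp

/-- A run of this program exists only if `reg r ≠ 0`: there are no legal queries. -/
def assertReg (r : ℕ) : Prog := .ite r .skip (.query 0 0 0 0)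

theorem exec_assertReg {W r : ℕ} {s s' : State} {t : ℕ} {Q : List ℕ}
    (h : Exec noOracle W (assertReg r) s t Q s') : s.reg r ≠ 0 ∧ s = s' := by
  cases h with
  | ite_true hr h => cases h; exact ⟨hr, rfl⟩
  | ite_false hr h => cases h with
    | query _ _ _ _ _ _ _ hq => exact hq.elim

/-- The replacement for the query `.query r A a l` of a program whose registers and arrays are
shifted by `50` and `20`. -/
def answerQuery (r A a l : ℕ) : Prog :=
  .seq (.seq (mov 17 (a + 50)) (mov 18 (l + 50))) (.seq guessClaim (.seq (checkRace (A + 20))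
    (.seq (assertReg 16) (.ite 10 (.const (r + 50) 1) (.const (r + 50) 0)))))

/-- The state `s'` of the simulation represents the state `s` of the simulated program: registers
are shifted by `50` and arrays by `20`, which leaves room for the verification of answers. -/
def Represents (s' s : State) : Prop :=
  (∀ r, s'.reg (r + 50) = s.reg r) ∧ ∀ A, s'.mem (A + 20) = s.mem A

theorem Represents.setReg {s' s : State} (h : Represents s' s) (r v : ℕ) :
    Represents (s'.setReg (r + 50) v) (s.setReg r v) := by
  refine ⟨fun r' => ?_, h.2⟩
  simp [h.1]

theorem Represents.setMem {s' s : State} (h : Represents s' s) (A i v : ℕ) :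
    Represents (s'.setMem (A + 20) i v) (s.setMem A i v) := by
  refine ⟨h.1, fun A' => ?_⟩
  funext i'
  simp [h.2]

theorem Represents.of_exec {O : Oracle} {W : ℕ} {p : Prog} {s' s'' s : State} {t : ℕ} {Q : List ℕ}
    (h : Represents s' s) (he : Exec O W p s' t Q s'') (hr : ∀ r, ¬ p.WritesReg (r + 50))
    (hA : ∀ A, ¬ p.WritesArr (A + 20)) : Represents s'' s :=
  ⟨fun r => by rw [he.reg_eq (hr r), h.1], fun A => by rw [he.mem_eq (hA A), h.2]⟩

theorem guessClaim_writesReg {r : ℕ} (hr : 13 ≤ r) : ¬ guessClaim.WritesReg r := by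
  simp [guessClaim, guessLabels, Prog.WritesReg]; omega

theorem guessClaim_writesArr {A : ℕ} (hA : 4 ≤ A) : ¬ guessClaim.WritesArr A := by
  simp [guessClaim, guessLabels, Prog.WritesArr]; omega

/-- The verification of an answer leaves the registers and arrays of the simulated program
unchanged. -/
theorem Represents.of_exec_verification {O : Oracle} {W W' W'' a l A t t' t'' : ℕ}
    {Q Q' Q'' : List ℕ} {s s₀ s₁ s₂ s₃ : State} (h : Represents s₀ s)
    (e1 : Exec O W (.seq (mov 17 (a + 50)) (mov 18 (l + 50))) s₀ t Q s₁)
    (e2 : Exec O W' guessClaim s₁ t' Q' s₂) (e3 : Exec O W'' (checkRace (A + 20)) s₂ t'' Q'' s₃) :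
    Represents s₃ s := by
  refine Represents.of_exec (Represents.of_exec (Represents.of_exec h e1 ?_ ?_) e2 ?_ ?_) e3 ?_ ?_
  · intro r; simp [mov, Prog.WritesReg]
  · intro A; simp [mov, Prog.WritesArr]
  · exact fun r => guessClaim_writesReg (by omega)
  · exact fun r => guessClaim_writesArr (by omega)
  · exact fun r => checkRace_writesReg (by omega)
  · exact fun r => checkRace_writesArr (by omega)

theorem thread_mem_eventsCode {es : List Event} {e : Event} (he : e ∈ es) :
    e.thread ∈ eventsCode es :=
  List.mem_flatMap.2 ⟨e, he, by simp [Event.code_eq]⟩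

theorem arg_mem_eventsCode {es : List Event} {e : Event} (he : e ∈ es) :
    e.arg ∈ eventsCode es :=
  List.mem_flatMap.2 ⟨e, he, by simp [Event.code_eq]⟩

theorem Explained.congr {K V K' V' : ℕ → ℕ} {es : List Event} (h : Explained K V es)
    (hK : ∀ e ∈ es, K' e.arg = K e.arg) (hV : ∀ e ∈ es, V' e.arg = V e.arg) :
    Explained K' V' es := by
  intro pre e post heq he
  have : e ∈ es := by simp [heq]
  rw [hK e this, hV e this]
  exact h pre e post heq he

/-- A claim can be verified only if it is true. -/
theorem Claim.iff_race {σ : Trace} {s : State} (h : Claim σ.events s) :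
    s.reg 10 ≠ 0 ↔ σ.HasLockSetRace := by
  unfold Claim at h
  split_ifs at h with h10
  · exact iff_of_true h10 (σ.hasLockSetRace_iff.2 ⟨_, _, h⟩)
  · exact iff_of_false h10 (Trace.not_hasLockSetRace_of_explained h)

/-- Every true answer has a certificate of words that occur in the trace. -/
theorem exists_exec_guessClaim {σ : Trace} {b : Bool} (hb : b = true ↔ σ.HasLockSetRace) {B : ℕ}
    (hB : 4 ≤ B) {s : State} (hs : s.Bounded B) (hσ : ∀ v ∈ eventsCode σ.events, v ≤ B) :
    ∃ s', Exec noOracle B guessClaim s (7 * σ.events.length + 5) [] s' ∧ s'.Bounded B ∧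
      s'.reg 10 = b.toNat ∧ Claim σ.events s' := by
  have hlen : (σ.events.map Event.arg).length = σ.events.length := by simp
  rw [← hlen]
  cases b with
  | true =>
    obtain ⟨x, g, h⟩ := σ.hasLockSetRace_iff.1 (hb.1 rfl)
    obtain ⟨⟨e, he, hew, heg⟩, -⟩ := id h
    have hx : x ≤ B := by
      have := hσ _ (arg_mem_eventsCode he)
      rwa [Event.Accesses.arg_eq (.inr hew)] at this
    have hg : g ≤ B := heg ▸ hσ _ (thread_mem_eventsCode he)
    obtain ⟨s', h1, h2, h10, h11, h12, -⟩ := exec_guessClaim (b := 1) (K := fun _ => 0)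
      (V := fun _ => 0) (by omega) (by omega) hx hg (σ.events.map Event.arg) (by
        intro v hv
        obtain ⟨e, he, rfl⟩ := List.mem_map.1 hv
        exact ⟨hσ _ (arg_mem_eventsCode he), by omega, by omega⟩) hs
    refine ⟨s', h1, h2, h10, ?_⟩
    rw [Claim, if_pos (by omega), h11, h12]
    exact h
  | false =>
    obtain ⟨K, V, h, hK, hV⟩ := Trace.exists_explained (fun hr => by simpa using hb.2 hr)
    obtain ⟨s', h1, h2, h10, -, -, h3⟩ := exec_guessClaim (b := 0) (x := 0) (g := 0) (K := K)
      (V := V) (by omega) (by omega) (by omega) (by omega) (σ.events.map Event.arg) (by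
        intro v hv
        obtain ⟨e, he, rfl⟩ := List.mem_map.1 hv
        refine ⟨hσ _ (arg_mem_eventsCode he), (hK _).trans (by omega), ?_⟩
        rcases hV e.arg with h | ⟨d, hd, h | h⟩ <;> rw [h]
        · omega
        · exact hσ _ (thread_mem_eventsCode hd)
        · exact hσ _ (arg_mem_eventsCode hd)) hs
    refine ⟨s', h1, h2, h10, ?_⟩
    rw [Claim, if_neg (by omega)]
    exact h.congr (fun e he => (h3 _ (List.mem_map_of_mem he)).1)
      (fun e he => (h3 _ (List.mem_map_of_mem he)).2)

theorem exec_movs {W a l : ℕ} {s : State} (h1 : s.reg (a + 50) ≤ W) (h2 : s.reg (l + 50) ≤ W) :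
    Exec noOracle W (.seq (mov 17 (a + 50)) (mov 18 (l + 50))) s 2 []
      ((s.setReg 17 (s.reg (a + 50))).setReg 18 (s.reg (l + 50))) := by
  have e1 := Exec.op (O := noOracle) (W := W) s .land 17 (a + 50) (a + 50)
    (by simpa [BinOp.eval] using h1)
  have e2 := Exec.op (O := noOracle) (W := W) (s.setReg 17 (s.reg (a + 50))) .land 18 (l + 50)
    (l + 50) (by simpa [BinOp.eval] using h2)
  simp [BinOp.eval] at e1 e2
  exact e1.seq e2

theorem block_movs {s s' : State} (h : Represents s' s) (A a l : ℕ) :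
    ((s'.setReg 17 (s'.reg (a + 50))).setReg 18 (s'.reg (l + 50))).block (A + 20)
      (((s'.setReg 17 (s'.reg (a + 50))).setReg 18 (s'.reg (l + 50))).reg 17)
      (((s'.setReg 17 (s'.reg (a + 50))).setReg 18 (s'.reg (l + 50))).reg 18) =
    s.block A (s.reg a) (s.reg l) := by
  simp [State.block, h.1, h.2]

theorem exec_answerQuery {r A a l m : ℕ} {b : Bool} {s s' : State} (h : Represents s' s)
    (hq : lockSetRace.oracle (s.block A (s.reg a) (s.reg l)) m b) {B : ℕ} (hB : 4 ≤ B)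
    (hs : s'.Bounded B) :
    ∃ s'' t, t ≤ (checkCost + 20) * (m + 1) ∧
      Exec noOracle (B + t) (answerQuery r A a l) s' t [] s'' ∧ s''.Bounded (B + t) ∧
      Represents s'' (s.setReg r b.toNat) := by
  obtain ⟨σ, hσ, rfl, hb⟩ := hq
  have e1 := exec_movs (hs.1 (a + 50)) (hs.1 (l + 50))
  have hblock := block_movs h A a l
  set s₁ := (s'.setReg 17 (s'.reg (a + 50))).setReg 18 (s'.reg (l + 50))
  have hs₁ : s₁.Bounded B := (hs.setReg 17 (hs.1 _)).setReg 18 (hs.1 _)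
  have hw : ∀ v ∈ eventsCode σ.events, v ≤ B := by
    intro v hv
    have hv' : v ∈ s.block A (s.reg a) (s.reg l) := by rw [← hσ]; exact hv
    rw [← hblock, State.block, List.mem_map] at hv'
    obtain ⟨j, -, rfl⟩ := hv'
    exact hs₁.2 _ _
  obtain ⟨s₂, e2, hs₂, h10, hcl⟩ := exists_exec_guessClaim hb hB hs₁ hw
  have hblock₂ : s₂.block (A + 20) (s₂.reg 17) (s₂.reg 18) = eventsCode σ.events := by
    rw [e2.reg_eq (guessClaim_writesReg (by norm_num)),
      e2.reg_eq (guessClaim_writesReg (by norm_num))]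
    have : eventsCode σ.events = s.block A (s.reg a) (s.reg l) := hσ
    rw [this, ← hblock]
    simp only [State.block, e2.mem_eq (guessClaim_writesArr (show 4 ≤ A + 20 by omega))]
  obtain ⟨s₃, ⟨W, t, ht, e3⟩, h16⟩ := reaches_checkRace (by omega) hblock₂
  obtain ⟨e3, hs₃⟩ := tame_checkRace (A + 20) e3 hB hs₂
  have h10₃ : s₃.reg 10 = b.toNat := by
    rw [e3.reg_eq, h10]
    simp [checkRace, forEvents, fetch, clearBody, labelBody, checkLabel, raceBody, foreignCount,
      countAccess, lockBody, ifEq, mov, inc, dec, Prog.WritesReg]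
  have hrep := h.of_exec_verification e1 e2 e3
  have e4 : Exec noOracle (B + t) (.ite 10 (.const (r + 50) 1) (.const (r + 50) 0)) s₃ 2 []
      (s₃.setReg (r + 50) b.toNat) := by
    cases b with
    | true => exact .ite_true (by simp [h10₃]) (.const _ _ _ (show 1 ≤ B + t by omega))
    | false => exact .ite_false (by simp [h10₃]) (.const _ _ _ (Nat.zero_le _))
  have ht' : B + t ≤ B + (2 + (7 * σ.events.length + 5 + (t + (2 + 2)))) := by omega
  refine ⟨s₃.setReg (r + 50) b.toNat, 2 + (7 * σ.events.length + 5 + (t + (2 + 2))), ?_, ?_, ?_,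
    hrep.setReg r _⟩
  · change _ ≤ (checkCost + 20) * (σ.events.length + 1)
    nlinarith
  · exact (e1.mono (by omega)).seq ((e2.mono (by omega)).seq ((e3.mono ht').seq
      (.seq (.ite_true (h16.2 hcl) (.skip _)) (e4.mono ht'))))
  · exact (hs₃.mono ht').setReg _ (by cases b <;> simp; omega)

theorem exists_exec_of_seq {O : Oracle} {W t : ℕ} {p q : Prog} {s s'' : State} {Q : List ℕ}
    (h : Exec O W (.seq p q) s t Q s'') :
    ∃ s' t₁ Q₁ t₂ Q₂, Exec O W p s t₁ Q₁ s' ∧ Exec O W q s' t₂ Q₂ s'' := by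
  cases h with
  | seq h1 h2 => exact ⟨_, _, _, _, _, h1, h2⟩

theorem represents_of_exec_answerQuery {r A a l m : ℕ} {b : Bool} {s s' s'' : State}
    (h : Represents s' s) (hq : lockSetRace.oracle (s.block A (s.reg a) (s.reg l)) m b)
    {W t : ℕ} {Q : List ℕ} (he : Exec noOracle W (answerQuery r A a l) s' t Q s'') :
    Represents s'' (s.setReg r b.toNat) := by
  obtain ⟨σ, hσ, rfl, hb⟩ := hq
  obtain ⟨s₁, _, _, _, _, e1, he⟩ := exists_exec_of_seq he
  obtain ⟨s₂, _, _, _, _, e2, he⟩ := exists_exec_of_seq he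
  obtain ⟨s₃, _, _, _, _, e3, he⟩ := exists_exec_of_seq he
  obtain ⟨s₄, _, _, _, _, e4, e5⟩ := exists_exec_of_seq he
  have hmov := exec_movs (W := max (s'.reg (a + 50)) (s'.reg (l + 50))) (le_max_left _ _)
    (le_max_right _ _)
  obtain rfl := Exec.unique (by simp [mov, Prog.Deterministic]) hmov e1
  have hblock₂ : s₂.block (A + 20) (s₂.reg 17) (s₂.reg 18) = eventsCode σ.events := by
    rw [e2.reg_eq (guessClaim_writesReg (by norm_num)),
      e2.reg_eq (guessClaim_writesReg (by norm_num))]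
    have : eventsCode σ.events = s.block A (s.reg a) (s.reg l) := hσ
    rw [this, ← block_movs h A a l]
    simp only [State.block, e2.mem_eq (guessClaim_writesArr (show 4 ≤ A + 20 by omega))]
  obtain ⟨s₃', ⟨_, _, _, e3'⟩, h16⟩ := reaches_checkRace (by omega) hblock₂
  obtain rfl := Exec.unique (checkRace_deterministic _) e3 e3'
  obtain ⟨hok, rfl⟩ := exec_assertReg e4
  have h10 : s₃.reg 10 = s₂.reg 10 := by
    apply e3.reg_eq
    simp [checkRace, forEvents, fetch, clearBody, labelBody, checkLabel, raceBody, foreignCount,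
      countAccess, lockBody, ifEq, mov, inc, dec, Prog.WritesReg]
  have hiff := (h16.1 hok).iff_race
  rw [← h10] at hiff
  have hrep := h.of_exec_verification e1 e2 e3
  have hb' : b = true ↔ s₃.reg 10 ≠ 0 := hb.trans hiff.symm
  cases e5 with
  | ite_true h0 e5 =>
    cases e5
    rw [hb'.2 h0]
    exact hrep.setReg r 1
  | ite_false h0 e5 =>
    cases e5
    have : b = false := by simpa [h0] using hb'
    rw [this]
    exact hrep.setReg r 0

/-! ### The simulation of a reduction -/

/-- The program `p` with its registers and arrays shifted by `50` and `20`, and with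
guessed and verified answers to its queries. -/
def simulate : Prog → Prog
  | .skip => .skip
  | .const r v => .const (r + 50) v
  | .op o r a b => .op o (r + 50) (a + 50) (b + 50)
  | .load r A a => .load (r + 50) (A + 20) (a + 50)
  | .store A a r => .store (A + 20) (a + 50) (r + 50)
  | .seq p q => .seq (simulate p) (simulate q)
  | .ite r p q => .ite (r + 50) (simulate p) (simulate q)
  | .loop r p => .loop (r + 50) (simulate p)
  | .guess r => .guess (r + 50)
  | .query r A a l => answerQuery r A a l

/-- Some run of the simulation guesses all answers and certificates correctly. Its time is
bounded by the time of the simulated run and the total size of its queries. -/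
theorem exec_simulate {p : Prog} {W t : ℕ} {Q : List ℕ} {s s₁ : State}
    (h : Exec lockSetRace.oracle W p s t Q s₁) :
    ∀ (s' : State) (B : ℕ), Represents s' s → s'.Bounded B → 4 ≤ B → W ≤ B →
      ∃ s₁' t', t' ≤ (checkCost + 20) * (t + Q.sum) ∧
        Exec noOracle (B + t') (simulate p) s' t' [] s₁' ∧ s₁'.Bounded (B + t') ∧
        Represents s₁' s₁ := by
  have h1 : 1 ≤ (checkCost + 20) * (1 + ([] : List ℕ).sum) := by simp
  induction h with
  | skip s =>
    intro s' B hr hs hB hW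
    exact ⟨s', 1, h1, .skip _, hs.mono (by omega), hr⟩
  | const s r v hv =>
    intro s' B hr hs hB hW
    exact ⟨_, 1, h1, .const _ _ _ (by omega), (hs.mono (by omega)).setReg _ (by omega),
      hr.setReg r v⟩
  | op s o r a b hv =>
    intro s' B hr hs hB hW
    have he : o.eval (s'.reg (a + 50)) (s'.reg (b + 50)) = o.eval (s.reg a) (s.reg b) := by
      rw [hr.1, hr.1]
    refine ⟨_, 1, h1, .op _ _ _ _ _ (by omega), (hs.mono (by omega)).setReg _ (by omega), ?_⟩
    rw [he]
    exact hr.setReg r _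
  | load s r A a hv =>
    intro s' B hr hs hB hW
    have he : s'.mem (A + 20) (s'.reg (a + 50)) = s.mem A (s.reg a) := by
      rw [hr.1, hr.2]
    refine ⟨_, 1, h1, .load _ _ _ _ (by omega), (hs.mono (by omega)).setReg _ (by omega), ?_⟩
    rw [he]
    exact hr.setReg r _
  | store s A a r hv =>
    intro s' B hr hs hB hW
    have he := hr.1 r
    refine ⟨_, 1, h1, .store _ _ _ _ (by omega), (hs.mono (by omega)).setMem _ _ (by omega), ?_⟩
    rw [he, hr.1 a]
    exact hr.setMem A _ _
  | seq _ _ ih1 ih2 =>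
    intro s' B hr hs hB hW
    obtain ⟨s₁, t₁, ht₁, e₁, hs₁, hr₁⟩ := ih1 s' B hr hs hB hW
    obtain ⟨s₂, t₂, ht₂, e₂, hs₂, hr₂⟩ := ih2 s₁ (B + t₁) hr₁ hs₁ (by omega) (by omega)
    refine ⟨s₂, t₁ + t₂, ?_, .seq (e₁.mono (by omega)) (e₂.mono (by omega)), hs₂.mono (by omega),
      hr₂⟩
    rw [List.sum_append]
    linarith
  | ite_true h0 _ ih =>
    intro s' B hr hs hB hW
    obtain ⟨s₁, t₁, ht₁, e₁, hs₁, hr₁⟩ := ih s' B hr hs hB hW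
    refine ⟨s₁, t₁ + 1, by linarith, .ite_true (by rwa [hr.1]) (e₁.mono (by omega)),
      hs₁.mono (by omega), hr₁⟩
  | ite_false h0 _ ih =>
    intro s' B hr hs hB hW
    obtain ⟨s₁, t₁, ht₁, e₁, hs₁, hr₁⟩ := ih s' B hr hs hB hW
    refine ⟨s₁, t₁ + 1, by linarith, .ite_false (by rwa [hr.1]) (e₁.mono (by omega)),
      hs₁.mono (by omega), hr₁⟩
  | loop_done h0 =>
    intro s' B hr hs hB hW
    exact ⟨s', 1, h1, .loop_done (by rwa [hr.1]), hs.mono (by omega), hr⟩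
  | loop_again h0 _ _ ih1 ih2 =>
    intro s' B hr hs hB hW
    obtain ⟨s₁, t₁, ht₁, e₁, hs₁, hr₁⟩ := ih1 s' B hr hs hB hW
    obtain ⟨s₂, t₂, ht₂, e₂, hs₂, hr₂⟩ := ih2 s₁ (B + t₁) hr₁ hs₁ (by omega) (by omega)
    refine ⟨s₂, t₁ + t₂ + 1, ?_, .loop_again (by rwa [hr.1]) (e₁.mono (by omega))
      (e₂.mono (by omega)), hs₂.mono (by omega), hr₂⟩
    rw [List.sum_append]
    linarith
  | guess s r v hv =>
    intro s' B hr hs hB hW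
    exact ⟨_, 1, h1, .guess _ _ v (by omega), (hs.mono (by omega)).setReg _ (by omega),
      hr.setReg r v⟩
  | query s r A a l m b hq hv =>
    intro s' B hr hs hB hW
    obtain ⟨s₁, t₁, ht₁, e₁, hs₁, hr₁⟩ := exec_answerQuery (r := r) hr hq hB hs
    exact ⟨s₁, t₁, by simpa [Nat.add_comm] using ht₁, e₁, hs₁, hr₁⟩

/-- Every run of the simulation ends in the state in which the simulated program ends. -/
theorem represents_of_exec_simulate {p : Prog} (hd : p.Deterministic) {W t : ℕ} {Q : List ℕ}
    {s s₁ : State} (h : Exec lockSetRace.oracle W p s t Q s₁) :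
    ∀ {s' s₁' : State} {W' t' : ℕ} {Q' : List ℕ}, Represents s' s →
      Exec noOracle W' (simulate p) s' t' Q' s₁' → Represents s₁' s₁ := by
  induction h with
  | skip s => intro s' s₁' W' t' Q' hr h'; cases h'; exact hr
  | const s r v hv => intro s' s₁' W' t' Q' hr h'; cases h'; exact hr.setReg r v
  | op s o r a b hv =>
    intro s' s₁' W' t' Q' hr h'
    cases h'
    rw [hr.1, hr.1]
    exact hr.setReg r _
  | load s r A a hv =>
    intro s' s₁' W' t' Q' hr h'
    cases h'
    rw [hr.1, hr.2]
    exact hr.setReg r _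
  | store s A a r hv =>
    intro s' s₁' W' t' Q' hr h'
    cases h'
    rw [hr.1, hr.1]
    exact hr.setMem A _ _
  | seq _ _ ih1 ih2 =>
    intro s' s₁' W' t' Q' hr h'
    cases h' with
    | seq h1 h2 => exact ih2 hd.2 (ih1 hd.1 hr h1) h2
  | ite_true h0 _ ih =>
    intro s' s₁' W' t' Q' hr h'
    cases h' with
    | ite_true _ h1 => exact ih hd.1 hr h1
    | ite_false h2 _ => rw [hr.1] at h2; exact absurd h2 h0
  | ite_false h0 _ ih =>
    intro s' s₁' W' t' Q' hr h'
    cases h' with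
    | ite_true h2 _ => rw [hr.1] at h2; exact absurd h0 h2
    | ite_false _ h1 => exact ih hd.2 hr h1
  | loop_done h0 =>
    intro s' s₁' W' t' Q' hr h'
    cases h' with
    | loop_done _ => exact hr
    | loop_again h2 _ _ => rw [hr.1] at h2; exact absurd h0 h2
  | loop_again h0 _ _ ih1 ih2 =>
    intro s' s₁' W' t' Q' hr h'
    cases h' with
    | loop_done h2 => rw [hr.1] at h2; exact absurd h2 h0
    | loop_again _ h1 h2 => exact ih2 hd (ih1 hd hr h1) h2
  | guess s r v hv => exact hd.elim
  | query s r A a l m b hq hv =>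
    intro s' s₁' W' t' Q' hr h'
    exact represents_of_exec_answerQuery hr hq h'

/-! ### The negation of a formula -/

/-- The formula in which every literal is negated. As a CNF formula it is the negation of the
original DNF formula. -/
def Formula.negate {k : ℕ} (φ : Formula k) : Formula k where
  vars := φ.vars
  clauses := φ.clauses.map (List.map fun l => (l.1, !l.2))
  nodup := by
    refine φ.nodup.map (List.map_injective_iff.2 ?_)
    rintro ⟨i, b⟩ ⟨j, c⟩ h
    simpa using h
  width := by
    intro c hc
    obtain ⟨d, hd, rfl⟩ := List.mem_map.1 hc
    rw [List.length_map]
    exact φ.width d hd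
  inRange := by
    intro c hc l hl
    obtain ⟨d, hd, rfl⟩ := List.mem_map.1 hc
    obtain ⟨l', hl', rfl⟩ := List.mem_map.1 hl
    exact φ.inRange d hd l' hl'

theorem Formula.cnfSatisfiable_negate {k : ℕ} (φ : Formula k) :
    φ.negate.CNFSatisfiable ↔ ¬ φ.DNFTautology := by
  simp only [CNFSatisfiable, DNFTautology, negate, List.forall_mem_map]
  push Not
  refine exists_congr fun v => forall₂_congr fun c _ => ⟨?_, ?_⟩
  · rintro ⟨l', hl', h⟩
    obtain ⟨l, hl, rfl⟩ := List.mem_map.1 hl'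
    exact ⟨l, hl, Bool.eq_not.1 h⟩
  · rintro ⟨l, hl, h⟩
    exact ⟨_, List.mem_map.2 ⟨l, hl, rfl⟩, Bool.eq_not.2 h⟩

/-- On codes of literals: the code of the negated literal. -/
def negateWord (v : ℕ) : ℕ := if v % 2 = 0 then v + 1 else v - 1

/-- Negates the literals in a word list that starts with the last `c` literals of a clause and goes
on with further clauses, each of them preceded by its length. -/
def negateWords : ℕ → List ℕ → List ℕ
  | _, [] => []
  | 0, v :: vs => v :: negateWords v vs
  | c + 1, v :: vs => negateWord v :: negateWords c vs

theorem length_negateWords (c : ℕ) (vs : List ℕ) : (negateWords c vs).length = vs.length := by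
  induction vs generalizing c with
  | nil => cases c <;> rfl
  | cons v vs ih => cases c <;> simp [negateWords, ih]

theorem sum_negateWords_le (c : ℕ) (vs : List ℕ) :
    (negateWords c vs).sum ≤ vs.sum + vs.length := by
  induction vs generalizing c with
  | nil => cases c <;> simp [negateWords]
  | cons v vs ih =>
    cases c with
    | zero =>
      have := ih v
      simp only [negateWords, List.sum_cons, List.length_cons]; omega
    | succ c =>
      have := ih c
      have : negateWord v ≤ v + 1 := by unfold negateWord; split_ifs <;> omega
      simp only [negateWords, List.sum_cons, List.length_cons]; omega

theorem negateWord_litCode (l : ℕ × Bool) : negateWord (litCode l) = litCode (l.1, !l.2) := by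
  rcases l with ⟨i, _ | _⟩ <;> simp [negateWord, litCode]

theorem negateWords_clause (c : List (ℕ × Bool)) (vs : List ℕ) :
    negateWords c.length (c.map litCode ++ vs) =
      (c.map fun l => (l.1, !l.2)).map litCode ++ negateWords 0 vs := by
  induction c with
  | nil => rfl
  | cons l c ih => simp [negateWords, negateWord_litCode, ih]

theorem negateWords_clausesCode (cs : List (List (ℕ × Bool))) :
    negateWords 0 (clausesCode cs) = clausesCode (cs.map (List.map fun l => (l.1, !l.2))) := by
  induction cs with
  | nil => rfl
  | cons c cs ih =>
    have h : ∀ d ds, clausesCode (d :: ds) = d.length :: (d.map litCode ++ clausesCode ds) :=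
      fun _ _ => rfl
    rw [h, negateWords, negateWords_clause, ih, List.map_cons, h, List.length_map]

theorem Formula.code_negate {k : ℕ} (φ : Formula k) :
    φ.negate.code = φ.vars :: negateWords 0 (clausesCode φ.clauses) := by
  rw [negateWords_clausesCode]
  rfl

theorem Formula.length_code_negate {k : ℕ} (φ : Formula k) :
    φ.negate.code.length = φ.code.length := by
  rw [code_negate, code, List.length_cons, length_negateWords, List.length_cons]

theorem Formula.sum_code_negate_le {k : ℕ} (φ : Formula k) :
    φ.negate.code.sum ≤ φ.code.sum + φ.code.length := by
  have := sum_negateWords_le 0 (clausesCode φ.clauses)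
  rw [code_negate, code, List.sum_cons, List.sum_cons, List.length_cons]
  omega

theorem Formula.length_clauses_le {k : ℕ} (φ : Formula k) :
    φ.clauses.length ≤ (2 * φ.vars + 1) ^ k := by
  classical
  -- a clause is determined by its entries at the positions below `k`
  let f : List (ℕ × Bool) → Fin k → Option (ℕ × Bool) := fun d i => d[i.val]?
  let S : Finset (Option (ℕ × Bool)) :=
    insert none ((Finset.range φ.vars ×ˢ Finset.univ).image some)
  have hS : S.card ≤ 2 * φ.vars + 1 := by
    refine (Finset.card_insert_le _ _).trans (Nat.add_le_add_right ?_ 1)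
    refine Finset.card_image_le.trans ?_
    simp [mul_comm]
  have hmaps : ∀ d ∈ φ.clauses.toFinset, f d ∈ Fintype.piFinset fun _ : Fin k => S := by
    intro d hd
    rw [List.mem_toFinset] at hd
    rw [Fintype.mem_piFinset]
    intro i
    cases hi : d[i.val]? with
    | none => simp [f, S, hi]
    | some l =>
      have := φ.inRange d hd l (List.mem_of_getElem? hi)
      simp only [f, S, hi, Finset.mem_insert, Finset.mem_image]
      exact .inr ⟨l, by simp [this], rfl⟩
  have hinj : Set.InjOn f φ.clauses.toFinset := by
    intro c hc d hd h
    rw [Finset.mem_coe, List.mem_toFinset] at hc hd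
    refine List.ext_getElem? fun i => ?_
    by_cases hi : i < k
    · exact congrFun h ⟨i, hi⟩
    · rw [List.getElem?_eq_none (by have := φ.width c hc; omega),
        List.getElem?_eq_none (by have := φ.width d hd; omega)]
  rw [← List.toFinset_card_of_nodup φ.nodup]
  refine (Finset.card_le_card_of_injOn f hmaps hinj).trans ?_
  rw [Fintype.card_piFinset_const]
  exact Nat.pow_le_pow_left hS k

theorem Formula.length_code_le {k : ℕ} (φ : Formula k) :
    φ.code.length ≤ 1 + (k + 1) * (2 * φ.vars + 1) ^ k := by
  have h : ∀ cs : List (List (ℕ × Bool)), (∀ c ∈ cs, c.length ≤ k) →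
      (clausesCode cs).length ≤ (k + 1) * cs.length := by
    intro cs
    induction cs with
    | nil => simp [clausesCode]
    | cons c cs ih =>
      intro h
      have h1 := ih fun d hd => h d (by simp [hd])
      have h2 := h c (by simp)
      have h3 : clausesCode (c :: cs) = c.length :: (c.map litCode ++ clausesCode cs) := rfl
      rw [h3, List.length_cons, List.length_append, List.length_map, List.length_cons]
      linarith
  have h1 := h φ.clauses φ.width
  have h2 := Nat.mul_le_mul_left (k + 1) φ.length_clauses_le
  rw [code, List.length_cons]
  omega

/-! ### The preparation of the input -/

/-- Negates the literal in register `3`. -/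
def negateReg : Prog :=
  .seq (.const 8 2) (.seq (.op .mod 8 3 8) (.ite 8 (dec 3 1) (inc 3)))

/-- Copies one word from array `0` to array `20`, negated if it is a literal. Register `1` is the
address, register `2` the number of remaining words, and register `7` the number of remaining
literals of the current clause. -/
def prepareBody : Prog :=
  .seq (.load 3 0 1) (.seq (.ite 7 (.seq negateReg (dec 7 1)) (mov 7 3))
    (.seq (.store 20 1 3) (.seq (inc 1) (dec 2 1))))

/-- Copies the code of a formula to array `20` and its length to register `50`, and negates all
literals in the copy. -/
def prepare : Prog :=
  .seq (.seq (mov 50 0) (.seq (mov 2 0) (.seq (.const 1 0) (.seq (.const 7 0) (.seq (.load 3 0 1)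
    (.seq (.store 20 1 3) (.seq (inc 1) (dec 2 1)))))))) (.loop 2 prepareBody)

theorem prepareBody_straight : prepareBody.Straight := by
  simp [prepareBody, negateReg, mov, inc, dec, Prog.Straight]

theorem eval_prepareBody (s : State) :
    (prepareBody.eval s).reg 1 = s.reg 1 + 1 ∧ (prepareBody.eval s).reg 2 = s.reg 2 - 1 ∧
      (prepareBody.eval s).reg 7 =
        (if s.reg 7 = 0 then s.mem 0 (s.reg 1) else s.reg 7 - 1) ∧
      (prepareBody.eval s).mem 0 = s.mem 0 ∧
      ∀ j, (prepareBody.eval s).mem 20 j = if j = s.reg 1 then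
        (if s.reg 7 = 0 then s.mem 0 (s.reg 1) else negateWord (s.mem 0 (s.reg 1)))
        else s.mem 20 j := by
  have h0 : (prepareBody.eval s).mem 0 = s.mem 0 :=
    (prepareBody_straight.reaches s).mem_eq
      (by simp [prepareBody, negateReg, Prog.WritesArr, mov, inc, dec])
  by_cases h7 : s.reg 7 = 0
  · refine ⟨?_, ?_, ?_, h0, ?_⟩ <;>
      simp [prepareBody, Prog.eval, BinOp.eval, mov, inc, dec, h7]
  · by_cases hm : s.mem 0 (s.reg 1) % 2 = 0
    · refine ⟨?_, ?_, ?_, h0, ?_⟩ <;>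
        simp [prepareBody, negateReg, Prog.eval, BinOp.eval, mov, inc, dec, h7, hm, negateWord]
    · rw [Nat.mod_two_not_eq_zero] at hm
      refine ⟨?_, ?_, ?_, h0, ?_⟩ <;>
        simp [prepareBody, negateReg, Prog.eval, BinOp.eval, mov, inc, dec, h7, hm, negateWord]

theorem reaches_loop_prepareBody (vs : List ℕ) :
    ∀ s : State, s.block 0 (s.reg 1) (s.reg 2) = vs →
      ∃ s', Reaches (.loop 2 prepareBody) s ((prepareBody.cost + 1) * vs.length + 1) s' ∧
        s'.block 20 (s.reg 1) vs.length = negateWords (s.reg 7) vs ∧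
        ∀ j, j < s.reg 1 ∨ s.reg 1 + vs.length ≤ j → s'.mem 20 j = s.mem 20 j := by
  induction vs with
  | nil =>
    intro s hb
    have h2 : s.reg 2 = 0 := by rw [← s.length_block 0 (s.reg 1) (s.reg 2), hb]; rfl
    exact ⟨s, (Reaches.loop_done h2).mono (by simp), by cases s.reg 7 <;> rfl, fun _ _ => rfl⟩
  | cons v vs ih =>
    intro s hb
    have h2 : s.reg 2 = vs.length + 1 := by
      rw [← s.length_block 0 (s.reg 1) (s.reg 2), hb, List.length_cons]
    rw [h2, State.block_succ, List.cons.injEq] at hb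
    obtain ⟨e1, e2, e7, em0, em20⟩ := eval_prepareBody s
    rw [h2, Nat.add_sub_cancel] at e2
    rw [hb.1] at e7
    obtain ⟨s', h3, h4, h5⟩ := ih (prepareBody.eval s)
      (by rw [e1, e2]; simpa only [State.block, em0] using hb.2)
    rw [e1] at h4 h5
    refine ⟨s', (Reaches.loop_again (by omega) (prepareBody_straight.reaches s) h3).mono ?_, ?_, ?_⟩
    · rw [List.length_cons]; linarith
    · rw [List.length_cons, State.block_succ, h4, h5 _ (.inl (by omega)), em20, if_pos rfl,
        e7, hb.1]
      cases s.reg 7 <;> simp [negateWords]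
    · intro j hj
      rw [List.length_cons] at hj
      rw [h5 j (by omega), em20, if_neg (by omega)]

theorem reaches_prepare {v : ℕ} {vs : List ℕ} :
    ∃ s', Reaches prepare (initState (v :: vs)) ((prepareBody.cost + 20) * (v :: vs).length) s' ∧
      Represents s' (initState (v :: negateWords 0 vs)) := by
  set s := initState (v :: vs) with hs
  have hst : (Prog.seq (mov 50 0) (.seq (mov 2 0) (.seq (.const 1 0) (.seq (.const 7 0)
      (.seq (.load 3 0 1) (.seq (.store 20 1 3) (.seq (inc 1) (dec 2 1)))))))).Straight := by
    simp [mov, inc, dec, Prog.Straight]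
  have r1 := hst.reaches s
  set s₁ := (Prog.seq (mov 50 0) (.seq (mov 2 0) (.seq (.const 1 0) (.seq (.const 7 0)
      (.seq (.load 3 0 1) (.seq (.store 20 1 3) (.seq (inc 1) (dec 2 1)))))))).eval s with hs₁
  have f1 : s₁.reg 1 = 1 := by simp [hs₁, Prog.eval, BinOp.eval, mov, inc, dec]
  have f2 : s₁.reg 2 = vs.length := by
    simp [hs₁, Prog.eval, BinOp.eval, mov, inc, dec, hs, initState]
  have f7 : s₁.reg 7 = 0 := by simp [hs₁, Prog.eval, BinOp.eval, mov, inc, dec]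
  have f50 : s₁.reg 50 = vs.length + 1 := by
    simp [hs₁, Prog.eval, BinOp.eval, mov, inc, dec, hs, initState]
  have g0 : ∀ j, s₁.mem 0 j = (v :: vs).getD j 0 := by
    intro j
    simp [hs₁, Prog.eval, BinOp.eval, mov, inc, dec, hs, initState]
  have g20 : ∀ j, s₁.mem 20 j = if j = 0 then v else 0 := by
    intro j
    simp [hs₁, Prog.eval, BinOp.eval, mov, inc, dec, hs, initState]
  obtain ⟨s₂, r2, h20, hout⟩ := reaches_loop_prepareBody vs s₁ (by
    rw [f1, f2]
    refine List.ext_getElem (by simp [State.block]) fun i h1 h2 => ?_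
    simp only [State.block, List.getElem_map, List.getElem_range, g0]
    rw [Nat.add_comm, List.getD_cons_succ, List.getD_eq_getElem _ _ h2])
  rw [f1, f7] at h20
  rw [f1] at hout
  refine ⟨s₂, (r1.seq r2).mono ?_, fun r => ?_, fun A => ?_⟩
  · simp only [mov, inc, dec, Prog.cost, List.length_cons]
    nlinarith
  · rw [r2.reg_eq (by
      simp [prepareBody, negateReg, Prog.WritesReg, mov, inc, dec])]
    rcases Nat.eq_zero_or_pos r with rfl | hr
    · simp [f50, initState, length_negateWords]
    · rw [r1.reg_eq (by simp [Prog.WritesReg, mov, inc, dec]; omega)]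
      simp [hs, initState, hr.ne']
  · rcases Nat.eq_zero_or_pos A with rfl | hA
    · funext j
      change s₂.mem 20 j = _
      rcases j with _ | j
      · rw [hout 0 (.inl (by omega)), g20]
        simp [initState]
      · have hlen := length_negateWords 0 vs
        simp only [initState, if_true, List.getD_cons_succ]
        by_cases hj : j < vs.length
        · rw [← h20, List.getD_eq_getElem _ _ (by simpa [State.block] using hj)]
          simp [State.block, Nat.add_comm]
        · rw [hout (j + 1) (.inr (by omega)), g20, if_neg (by omega),
            List.getD_eq_default _ _ (by omega)]
    · rw [r2.mem_eq (by simp [prepareBody, negateReg, Prog.WritesArr, mov, inc, dec]; omega),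
        r1.mem_eq (by simp [Prog.WritesArr, mov, inc, dec]; omega)]
      funext j
      simp [hs, initState, hA.ne']

theorem tame_prepare : Tame prepare := by
  repeat
    first
    | exact tame_const _ (by norm_num)
    | exact tame_mov _ _
    | exact tame_sub _ _ _
    | exact tame_mod _ _ _
    | exact tame_inc _
    | exact tame_dec _ (by norm_num)
    | exact tame_load _ _ _
    | exact tame_store _ _ _
    | refine Tame.seq ?_ ?_
    | refine Tame.ite _ ?_ ?_
    | refine Tame.loop _ ?_

theorem prepare_deterministic : prepare.Deterministic := by
  simp [prepare, prepareBody, negateReg, mov, inc, dec, Prog.Deterministic]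

/-! ### The nondeterministic program for tautologies -/

/-- If `R` decides satisfiability with race queries, this program decides whether a DNF formula is a
tautology: it accepts if `R` rejects the negated formula. -/
def tautProg (R : Prog) : Prog :=
  .seq prepare (.seq (simulate R) (.ite 50 (.const 0 0) (.const 0 1)))

theorem initState_bounded (x : List ℕ) : (initState x).Bounded (x.length + x.sum + 4) := by
  refine ⟨fun r => ?_, fun A i => ?_⟩
  · simp only [initState]
    split_ifs <;> omega
  · simp only [initState]
    split_ifs
    · by_cases hi : i < x.length
      · rw [List.getD_eq_getElem _ _ hi]
        have := List.le_sum_of_mem (List.getElem_mem hi)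
        omega
      · rw [List.getD_eq_default _ _ (by omega)]; omega
    · omega

theorem outputs_tautProg {R : Prog} {k : ℕ} {φ : Formula k} {W t : ℕ} {Q : List ℕ}
    (h : Outputs lockSetRace.oracle W R φ.negate.code t Q false) :
    ∃ W' t', Outputs noOracle W' (tautProg R) φ.code t' [] true ∧
      t' ≤ (prepareBody.cost + 20) * φ.code.length + (checkCost + 20) * (t + Q.sum) + 2 ∧
      W' ≤ W + φ.code.length + φ.code.sum + 4 + t' := by
  obtain ⟨s₂, h2, hans⟩ := h
  have hans' : s₂.reg 0 = 0 := by simpa using hans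
  obtain ⟨s₁', ⟨W₁, t₁, ht₁, e1⟩, hrep⟩ := reaches_prepare (v := φ.vars)
    (vs := clausesCode φ.clauses)
  rw [← Formula.code_negate] at hrep
  obtain ⟨e1, hb₁⟩ := tame_prepare e1 (by omega) (initState_bounded _)
  obtain ⟨s₂', t₂, ht₂, e2, hb₂, hrep₂⟩ := exec_simulate h2 s₁'
    (W + φ.code.length + φ.code.sum + 4 + t₁) hrep
    (hb₁.mono (by simp only [Formula.code]; omega)) (by omega) (by omega)
  refine ⟨W + φ.code.length + φ.code.sum + 4 + (t₁ + (t₂ + 2)), t₁ + (t₂ + 2),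
    ⟨s₂'.setReg 0 1, ?_, by simp⟩, ?_, le_rfl⟩
  · refine .seq (Q := []) (e1.mono ?_) (.seq (Q := []) (e2.mono (by omega)) (.ite_false ?_ ?_))
    · simp only [Formula.code]; omega
    · have := hrep₂.1 0
      rw [hans'] at this
      exact this
    · exact .const _ _ _ (by omega)
  · simp only [Formula.code] at ht₁ ⊢
    omega

theorem eq_false_of_outputs_tautProg {R : Prog} (hR : R.Deterministic) {k : ℕ} {φ : Formula k}
    {W t : ℕ} {Q : List ℕ} {b : Bool}
    (h : Outputs lockSetRace.oracle W R φ.negate.code t Q b) {W' t' : ℕ} {Q' : List ℕ}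
    (h' : Outputs noOracle W' (tautProg R) φ.code t' Q' true) : b = false := by
  obtain ⟨s₂, h2, hans⟩ := h
  obtain ⟨s', h', hs'⟩ := h'
  obtain ⟨s₁, _, _, _, _, e1, h'⟩ := exists_exec_of_seq h'
  obtain ⟨s₂', _, _, _, _, e2, e3⟩ := exists_exec_of_seq h'
  obtain ⟨s₁', ⟨W₁, t₁, ht₁, e1'⟩, hrep⟩ := reaches_prepare (v := φ.vars)
    (vs := clausesCode φ.clauses)
  obtain rfl := Exec.unique prepare_deterministic e1' e1
  rw [← Formula.code_negate] at hrep
  have hrep₂ := represents_of_exec_simulate hR h2 hrep e2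
  have h50 := hrep₂.1 0
  rw [← h50] at hans
  cases e3 with
  | ite_true h0 e3 =>
    cases e3
    simp at hs'
  | ite_false h0 e3 => simpa [h0] using hans

/-! ### Time bounds -/

/-- The bound of `Formula.length_code_le` is `O(2 ^ (n / 2))`. -/
theorem exists_polynomial_le (k : ℕ) : ∃ C : ℕ, ∀ n : ℕ,
    ((1 + (k + 1) * (2 * n + 1) ^ k : ℕ) : ℝ) ≤ C * (2 : ℝ) ^ ((n : ℝ) * (1 / 2)) := by
  set r : ℝ := (2 : ℝ) ^ (1 / 2 : ℝ) with hr
  have hr1 : 1 < r := Real.one_lt_rpow (by norm_num) (by norm_num)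
  have hpow : ∀ n : ℕ, (2 : ℝ) ^ ((n : ℝ) * (1 / 2)) = r ^ n := by
    intro n
    rw [hr, ← Real.rpow_natCast, ← Real.rpow_mul (by norm_num), mul_comm]
  obtain ⟨M, hM⟩ := (tendsto_pow_const_div_const_pow_of_one_lt k hr1).bddAbove_range
  have hM' : ∀ n : ℕ, (n : ℝ) ^ k ≤ M * r ^ n := by
    intro n
    have := hM ⟨n, rfl⟩
    rwa [div_le_iff₀ (by positivity)] at this
  obtain ⟨C, hC⟩ := exists_nat_ge (1 + (k + 1) * (3 ^ k * (M * r)))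
  refine ⟨C, fun n => ?_⟩
  rw [hpow]
  have hrn : 1 ≤ r ^ n := one_le_pow₀ hr1.le
  have h1 : ((2 * n + 1 : ℕ) : ℝ) ^ k ≤ 3 ^ k * (M * r ^ (n + 1)) := by
    calc ((2 * n + 1 : ℕ) : ℝ) ^ k ≤ (3 * ((n + 1 : ℕ) : ℝ)) ^ k := by
          gcongr
          push_cast
          linarith [(Nat.cast_nonneg n : (0 : ℝ) ≤ n)]
      _ = 3 ^ k * ((n + 1 : ℕ) : ℝ) ^ k := mul_pow _ _ _
      _ ≤ _ := by gcongr; exact hM' _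
  calc ((1 + (k + 1) * (2 * n + 1) ^ k : ℕ) : ℝ)
      = 1 + (k + 1) * ((2 * n + 1 : ℕ) : ℝ) ^ k := by push_cast; ring
    _ ≤ 1 * r ^ n + (k + 1) * (3 ^ k * (M * r ^ (n + 1))) := by gcongr; linarith
    _ = (1 + (k + 1) * (3 ^ k * (M * r))) * r ^ n := by ring
    _ ≤ C * r ^ n := by gcongr

/-- The word bound of the simulated reduction, with the additional input length and running time, is
again a word bound. -/
theorem wordBound_le {C D : ℕ} {T₀ T len sum sum' : ℝ} (h0 : 0 ≤ T₀) (hT : T₀ ≤ T) (hlen : 0 ≤ len)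
    (hs : 0 ≤ sum) (hs' : 0 ≤ sum') (hsum : sum' ≤ sum + len) :
    C * (T₀ + len + sum' + 1) ^ C + len + sum + 4 + D * T ≤
      ((C * 2 ^ C + 4 + D + C + 1 : ℕ) : ℝ) *
        (T + len + sum + 1) ^ (C * 2 ^ C + 4 + D + C + 1) := by
  set Z := T + len + sum + 1 with hZ
  have hZ1 : 1 ≤ Z := by linarith
  have hE : ∀ {j : ℕ}, j ≤ C * 2 ^ C + 4 + D + C + 1 → Z ^ j ≤ Z ^ (C * 2 ^ C + 4 + D + C + 1) :=
    fun h => pow_le_pow_right₀ hZ1 h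
  set E := Z ^ (C * 2 ^ C + 4 + D + C + 1)
  have h1 : (T₀ + len + sum' + 1) ^ C ≤ 2 ^ C * E := by
    calc (T₀ + len + sum' + 1) ^ C ≤ (2 * Z) ^ C := by
          gcongr
          linarith
      _ = 2 ^ C * Z ^ C := mul_pow _ _ _
      _ ≤ 2 ^ C * E := by
          gcongr
          exact hE (by omega)
  have h2 : Z ≤ E := by simpa using hE (j := 1) (by omega)
  have h3 : (C : ℝ) * (T₀ + len + sum' + 1) ^ C ≤ C * (2 ^ C * E) := by gcongr
  have h4 : (D : ℝ) * T ≤ D * E := by gcongr; linarith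
  have h5 : 0 ≤ (C + 1 : ℝ) * E := by positivity
  push_cast
  linarith

/-- A reduction whose queries cost `m = (m ^ (1 + ε)) ^ (1 - ε / (1 + ε))` yields a fast
nondeterministic program for tautologies. -/
theorem inNTIME_kTAUT {ε δ : ℝ} (hε : 0 < ε) (hδ : 0 < δ) {k : ℕ} {R : Prog} {C : ℕ}
    (hR : R.Deterministic)
    (h : ∀ x : (kSAT k).Inst, ∃ (W t : ℕ) (Q : List ℕ) (ans : Bool),
      Outputs lockSetRace.oracle W R ((kSAT k).encode x) t Q ans ∧
      (ans = true ↔ (kSAT k).Yes x) ∧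
      (t : ℝ) ≤ C * ((2 : ℝ) ^ (kSAT k).size x) ^ (1 - δ) ∧
      (W : ℝ) ≤ wordBound C (((2 : ℝ) ^ (kSAT k).size x) ^ (1 - δ)) ((kSAT k).encode x) ∧
      (Q.map fun m : ℕ => ((m : ℝ) ^ (1 + ε)) ^ (1 - ε / (1 + ε))).sum ≤
        C * ((2 : ℝ) ^ (kSAT k).size x) ^ (1 - δ)) :
    InNTIME (kTAUT k) fun n => (2 : ℝ) ^ ((n : ℝ) * (1 - min δ 1 / 2)) := by
  obtain ⟨P, hP⟩ := exists_polynomial_le k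
  set D := (prepareBody.cost + 20) * P + (checkCost + 20) * (2 * C) + 2 with hD
  refine ⟨tautProg R, C * 2 ^ C + 4 + D + C + 1, fun φ => ?_⟩
  change Formula k at φ
  obtain ⟨W, t, Q, ans, hout, hans, ht, hW, hQ⟩ := h φ.negate
  have hans' : ans = false ↔ φ.DNFTautology := by
    rw [← Bool.not_eq_true, hans]
    exact (not_congr φ.cnfSatisfiable_negate).trans not_not
  refine ⟨fun hyes => ?_, fun ⟨W', t', h'⟩ => hans'.1 (eq_false_of_outputs_tautProg hR hout h')⟩
  have hyes : φ.DNFTautology := hyes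
  rw [hans'.2 hyes] at hout
  obtain ⟨W', t', h1, h2, h3⟩ := outputs_tautProg hout
  set T₀ : ℝ := ((2 : ℝ) ^ φ.vars) ^ (1 - δ) with hT₀
  set T : ℝ := (2 : ℝ) ^ ((φ.vars : ℝ) * (1 - min δ 1 / 2)) with hT
  have ht : (t : ℝ) ≤ C * T₀ := ht
  have hW : (W : ℝ) ≤ C * (T₀ + (φ.negate.code.length : ℝ) + (φ.negate.code.sum : ℝ) + 1) ^ C := hW
  have h0 : 0 ≤ T₀ := by positivity
  have hT₀T : T₀ ≤ T := by
    rw [hT₀, hT, ← Real.rpow_natCast, ← Real.rpow_mul (by norm_num)]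
    refine Real.rpow_le_rpow_of_exponent_le (by norm_num) ?_
    gcongr
    have := min_le_left δ 1
    linarith
  -- the time for reading the formula is `O(2 ^ (n / 2))`
  have hhalf : (2 : ℝ) ^ ((φ.vars : ℝ) * (1 / 2)) ≤ T := by
    refine Real.rpow_le_rpow_of_exponent_le (by norm_num) ?_
    gcongr
    have := min_le_right δ 1
    linarith
  have hT1 : 1 ≤ T := le_trans (Real.one_le_rpow (by norm_num) (by positivity)) hhalf
  have hlen : (φ.code.length : ℝ) ≤ P * T := by
    refine le_trans (le_trans (Nat.cast_le.2 φ.length_code_le) (hP φ.vars)) ?_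
    gcongr
  have hQ' : ((Q.sum : ℕ) : ℝ) ≤ C * T₀ := by
    refine le_trans (le_of_eq ?_) hQ
    rw [Nat.cast_list_sum]
    congr 1
    refine List.map_congr_left fun m _ => ?_
    rw [← Real.rpow_mul (by positivity)]
    have : (1 + ε) * (1 - ε / (1 + ε)) = 1 := by field_simp; ring
    rw [this, Real.rpow_one]
  have ht' : (t' : ℝ) ≤ D * T := by
    have h2' : (t' : ℝ) ≤ (prepareBody.cost + 20) * φ.code.length +
        (checkCost + 20) * (t + Q.sum) + 2 := by exact_mod_cast h2
    have hCT : (C : ℝ) * T₀ ≤ C * T := by gcongr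
    calc (t' : ℝ) ≤ _ := h2'
      _ ≤ (prepareBody.cost + 20) * (P * T) + (checkCost + 20) * (C * T + C * T) + 2 * T := by
        gcongr <;> linarith
      _ = D * T := by rw [hD]; push_cast; ring
  refine ⟨W', t', h1, ht'.trans ?_, ?_⟩
  · change (D : ℝ) * T ≤ ((C * 2 ^ C + 4 + D + C + 1 : ℕ) : ℝ) * T
    gcongr
    omega
  · have h3' : (W' : ℝ) ≤ W + φ.code.length + φ.code.sum + 4 + t' := by exact_mod_cast h3
    rw [φ.length_code_negate] at hW
    have key := wordBound_le (C := C) (D := D) h0 hT₀T (Nat.cast_nonneg φ.code.length)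
      (Nat.cast_nonneg φ.code.sum) (Nat.cast_nonneg φ.negate.code.sum)
      (by exact_mod_cast φ.sum_code_negate_le)
    exact le_trans (by linarith) key

end RaceComplexity

theorem mainTheorem8 (ε : ℝ) (hε : 0 < ε) :
    RaceComplexity.FineGrainedReduction RaceComplexity.kSAT (fun n => (2 : ℝ) ^ n)
        RaceComplexity.lockSetRace (fun N => (N : ℝ) ^ (1 + ε)) →
      ¬ RaceComplexity.NSETH := by
  intro hred hseth
  -- with this exponent, the queries of the reduction may cost linear time
  obtain ⟨δ, hδ, h⟩ := hred (ε / (1 + ε)) (by positivity)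
  obtain ⟨k, hk⟩ := hseth (min δ 1 / 2) (by positivity)
  obtain ⟨R, C, hR, hx⟩ := h k
  exact hk (RaceComplexity.inNTIME_kTAUT hε hδ hR hx)
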